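/- Let $K$ be a finite field, and let $\nu, m_1, m_2, t$ be positive integers with $m_1\ge m_2\ge t+1$ and $2\nu\ge 2m_1+m_2+t+3$. Let $V$ be a $2\nu$-dimensional vector space over $K$ with a non-degenerate alternating bilinear form $f$. A subspace $F$ of $V$ is totally isotropic if $f(x,y)=0$ for all $x,y\in F$; let $\mathcal P_m$ be the set of all $m$-dimensional totally isotropic subspaces of $V$. Families $\mathcal F_1\subseteq\mathcal P_{m_1}$ and $\mathcal F_2\subseteq\mathcal P_{m_2}$ are cross $t$-intersecting if $\dim(F_1\cap F_2)\ge t$ for all $F_1\in\mathcal F_1$ and $F_2\in\mathcal F_2$; they are trivial if some $T\in\mathcal P_t$ is contained in every member of $\mathcal F_1$ and every member of $\mathcal F_2$, and non-trivial otherwise. For $M\in\mathcal P_{m_2+1}$, $T\in\mathcal P_t$ with $T\subseteq M$, and $S\in\mathcal P_{t+1}$, put $$\mathcal C_1(M,T;m,t)=\{F\in\mathcal P_m: T\subseteq F,\ \dim(F\cap M)\ge t+1\},$$ $$\mathcal C_2(M,T;m)=\{F\in\mathcal P_m: T\subseteq F\}\cup\{F\subseteq M:\ F\text{ a subspace},\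 \dim F=m\},$$ $$\mathcal C_3(S;m)=\{F\in\mathcal P_m: S\subseteq F\},\qquad \mathcal C_4(S;m,t)=\{F\in\mathcal P_m: \dim(F\cap S)\ge t\}.$$ Suppose that $\mathcal F_1\subseteq\mathcal P_{m_1}$ and $\mathcal F_2\subseteq\mathcal P_{m_2}$ are non-trivial cross $t$-intersecting families whose product of sizes $|\mathcal F_1||\mathcal F_2|$ is maximum among all pairs of non-trivial cross $t$-intersecting families in $\mathcal P_{m_1}$ and $\mathcal P_{m_2}$. (1) If $m_2>2t$ or $(m_1,m_2,t)\in\{(2,2,1),(3,2,1)\}$, then there are $M\in\mathcal P_{m_2+1}$ and $T\in\mathcal P_t$ with $T\subseteq M$ such that either $\mathcal F_1=\mathcal C_1(M,T;m_1,t)$ and $\mathcal F_2=\mathcal C_2(M,T;m_2)$, or $m_1=m_2$, $\mathcal F_1=\mathcal C_2(M,T;m_1)$ and $\mathcal F_2=\mathcal C_1(M,T;m_2,t)$. (2) If $m_2\le 2t$ and $(m_1,m_2,t)\notin\{(2,2,1),(3,2,1)\}$, then there is $S\in\mathcal P_{t+1}$ such that either $\mathcal F_1=\mathcal C_3(S;m_1)$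 and $\mathcal F_2=\mathcal C_4(S;m_2,t)$, or $m_1=m_2$, $\mathcal F_1=\mathcal C_4(S;m_1,t)$ and $\mathcal F_2=\mathcal C_3(S;m_2)$. -/

import Mathlib

open Module

namespace SymplecticPolar

variable {K V : Type*} [Field K] [AddCommGroup V] [Module K V]

/-- A subspace is totally isotropic for `B` when `B` vanishes identically on it. -/
def IsTotallyIsotropic (B : LinearMap.BilinForm K V) (F : Submodule K V) : Prop :=
  ∀ x ∈ F, ∀ y ∈ F, B x y = 0

/-- The set `𝒫_m` of all `m`-dimensional totally isotropic subspaces. -/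
def isotropicSubspaces (B : LinearMap.BilinForm K V) (m : ℕ) : Set (Submodule K V) :=
  {F | IsTotallyIsotropic B F ∧ finrank K F = m}

/-- Every member of the first family meets every member of the second one in dimension at
least `t`. -/
def CrossIntersecting (t : ℕ) (F₁ F₂ : Set (Submodule K V)) : Prop :=
  ∀ A ∈ F₁, ∀ C ∈ F₂, t ≤ finrank K ↥(A ⊓ C)

/-- A pair of families is trivial when one `t`-dimensional totally isotropic subspace lies in
every member of both families. -/
def IsTrivialPair (B : LinearMap.BilinForm K V) (t : ℕ) (F₁ F₂ : Set (Submodule K V)) : Prop :=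
  ∃ T ∈ isotropicSubspaces B t, (∀ F ∈ F₁, T ≤ F) ∧ (∀ F ∈ F₂, T ≤ F)

/-- Non-trivial cross `t`-intersecting families `F₁ ⊆ 𝒫_{m₁}`, `F₂ ⊆ 𝒫_{m₂}`. -/
structure IsNontrivialCross (B : LinearMap.BilinForm K V) (m₁ m₂ t : ℕ)
    (F₁ F₂ : Set (Submodule K V)) : Prop where
  subset_left : F₁ ⊆ isotropicSubspaces B m₁
  subset_right : F₂ ⊆ isotropicSubspaces B m₂
  cross : CrossIntersecting t F₁ F₂
  nontrivial : ¬ IsTrivialPair B t F₁ F₂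

/-- The product of sizes is maximum among all pairs of non-trivial cross `t`-intersecting
families in `𝒫_{m₁}` and `𝒫_{m₂}`. -/
def IsMaxNontrivialCross (B : LinearMap.BilinForm K V) (m₁ m₂ t : ℕ)
    (F₁ F₂ : Set (Submodule K V)) : Prop :=
  IsNontrivialCross B m₁ m₂ t F₁ F₂ ∧
    ∀ G₁ G₂ : Set (Submodule K V), IsNontrivialCross B m₁ m₂ t G₁ G₂ →
      G₁.ncard * G₂.ncard ≤ F₁.ncard * F₂.ncard

/-- `𝒞₁(M, T; m, t) = {F ∈ 𝒫_m : T ⊆ F, dim (F ∩ M) ≥ t + 1}`. -/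
def C₁ (B : LinearMap.BilinForm K V) (M T : Submodule K V) (m t : ℕ) : Set (Submodule K V) :=
  {F | F ∈ isotropicSubspaces B m ∧ T ≤ F ∧ t + 1 ≤ finrank K ↥(F ⊓ M)}

/-- `𝒞₂(M, T; m)`: the `F ∈ 𝒫_m` with `T ⊆ F`, and all `m`-dimensional subspaces of `M`. -/
def C₂ (B : LinearMap.BilinForm K V) (M T : Submodule K V) (m : ℕ) : Set (Submodule K V) :=
  {F | F ∈ isotropicSubspaces B m ∧ T ≤ F} ∪ {F | F ≤ M ∧ finrank K F = m}

/-- `𝒞₃(S; m) = {F ∈ 𝒫_m : S ⊆ F}`. -/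
def C₃ (B : LinearMap.BilinForm K V) (S : Submodule K V) (m : ℕ) : Set (Submodule K V) :=
  {F | F ∈ isotropicSubspaces B m ∧ S ≤ F}

/-- `𝒞₄(S; m, t) = {F ∈ 𝒫_m : dim (F ∩ S) ≥ t}`. -/
def C₄ (B : LinearMap.BilinForm K V) (S : Submodule K V) (m t : ℕ) : Set (Submodule K V) :=
  {F | F ∈ isotropicSubspaces B m ∧ t ≤ finrank K ↥(F ⊓ S)}

end SymplecticPolar

/-! Write [n] = 1 + q + ⋯ + q^(n-1) (`qNum`) and N_m(k) (`isoNum`) for the number of m-dimensional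
totally isotropic subspaces through a fixed k-dimensional one. Since X^⊥/X is symplectic of
dimension 2(ν-k), one has [m-k]·N_m(k) = [2(ν-k)]·N_m(k+1). As ν is large, raising k by one costs a
factor that outweighs the few Gaussian integers it has to pay for; all estimates are of this kind.

Let a, b be the two dimensions and U = N_a(t+1)·N_b(t). The pairs (C₃, C₄) and (C₁, C₂) are
non-trivial, with products at least 3/4 of [t+1]·U and of [b-t+1]·U, so a maximum pair F, G
satisfies both lower bounds.

The upper bounds come from covers: isotropic subspaces that meet every member of a family in
dimension at least t. If X is not a cover of F, then all members of G through X pass through one of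
[a-t+1] one-dimensional extensions of X; iterating bounds the members through X. Conversely each
member of G contains a t-subspace of any cover of G. If the smallest covers of both families had
dimension above t, the product would be too small (`exists_common_of_large`). Hence some T of
dimension t lies in every member of one family, say F. Then the smallest covers of G have dimension
t+1 (`structure_of_common`). Either the members of F share a (t+1)-space, which must cover G and
gives C₃, C₄; or all (t+1)-covers of G contain T and span a space M of dimension b+1, which gives
C₁, C₂. Maximality turns these inclusions into equalities.

It remains to compare numbers. The leading terms [t+1]·U and [b-t+1]·U make b against 2t decisive;
at b = 2t they tie, and the second-order terms favour C₃, C₄ except for the two small triples. When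
b < a, exchanging the roles of the dimensions replaces U by U·[b-t]/[a-t] ≤ U/2, so the exchanged
pairs lose. -/

namespace SymplecticPolar

/-! ### Gaussian integers -/

section QNumber

/-- The Gaussian integer `[n]_q = 1 + q + ⋯ + q ^ (n - 1)`. -/
def qNum (q : ℝ) (n : ℕ) : ℝ := ∑ i ∈ Finset.range n, q ^ i

theorem qNum_zero (q : ℝ) : qNum q 0 = 0 := by simp [qNum]

theorem qNum_one (q : ℝ) : qNum q 1 = 1 := by simp [qNum]

theorem qNum_succ (q : ℝ) (n : ℕ) : qNum q (n + 1) = q * qNum q n + 1 := by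
  unfold qNum
  rw [Finset.sum_range_succ', Finset.mul_sum]
  simp [pow_succ']

theorem qNum_succ_pow (q : ℝ) (n : ℕ) : qNum q (n + 1) = qNum q n + q ^ n :=
  Finset.sum_range_succ _ _

theorem sub_one_mul_qNum (q : ℝ) (n : ℕ) : (q - 1) * qNum q n = q ^ n - 1 := mul_geom_sum q n

theorem qNum_add (q : ℝ) (m n : ℕ) : qNum q (m + n) = qNum q m + q ^ m * qNum q n := by
  induction n with
  | zero => simp [qNum_zero]
  | succ n ih => rw [← add_assoc, qNum_succ_pow, qNum_succ_pow, ih]; ring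

variable {q : ℝ}

theorem qNum_nonneg (hq : 2 ≤ q) (n : ℕ) : 0 ≤ qNum q n :=
  Finset.sum_nonneg fun i _ => by positivity

theorem qNum_mono (hq : 2 ≤ q) {m n : ℕ} (h : m ≤ n) : qNum q m ≤ qNum q n := by
  obtain ⟨k, rfl⟩ := Nat.exists_eq_add_of_le h
  rw [qNum_add]
  have := qNum_nonneg hq k
  have : 0 ≤ q ^ m * qNum q k := by positivity
  linarith

theorem one_le_qNum (hq : 2 ≤ q) {n : ℕ} (h : 1 ≤ n) : 1 ≤ qNum q n := by
  simpa [qNum_one] using qNum_mono hq h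

theorem qNum_pos (hq : 2 ≤ q) {n : ℕ} (h : 1 ≤ n) : 0 < qNum q n :=
  lt_of_lt_of_le one_pos (one_le_qNum hq h)

theorem qNum_le_pow (hq : 2 ≤ q) (n : ℕ) : qNum q n ≤ q ^ n := by
  have h := sub_one_mul_qNum q n
  have := qNum_nonneg hq n
  nlinarith

theorem qNum_mul_le (hq : 2 ≤ q) (m n : ℕ) : qNum q m * qNum q n ≤ qNum q (m + n) := by
  rw [qNum_add]
  nlinarith [qNum_le_pow hq m, qNum_nonneg hq m, qNum_nonneg hq n]

theorem pow_mul_qNum_le (hq : 2 ≤ q) (k n : ℕ) : q ^ k * qNum q n ≤ qNum q (k + n) := by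
  rw [qNum_add]
  have := qNum_nonneg hq k
  linarith

theorem two_pow_mul_qNum_le (hq : 2 ≤ q) (k n : ℕ) : 2 ^ k * qNum q n ≤ qNum q (k + n) := by
  refine le_trans ?_ (pow_mul_qNum_le hq k n)
  have := qNum_nonneg hq n
  gcongr

end QNumber

/-! ### One-dimensional extensions of a subspace -/

section Subspaces

variable {K V : Type*} [Field K] [AddCommGroup V] [Module K V]

/-- The subspaces `Y` with `X ≤ Y ≤ Z` whose dimension is one more than that of `X`. -/
def pts (X Z : Submodule K V) : Set (Submodule K V) :=
  {Y | X ≤ Y ∧ Y ≤ Z ∧ finrank K Y = finrank K X + 1}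

theorem finrank_sup_span_singleton [FiniteDimensional K V] {X : Submodule K V} {v : V}
    (hv : v ∉ X) : finrank K ↥(X ⊔ K ∙ v) = finrank K X + 1 := by
  have h := Submodule.finrank_sup_add_finrank_inf_eq X (K ∙ v)
  have h0 : v ≠ 0 := fun h => hv (h ▸ X.zero_mem)
  have h1 : X ⊓ K ∙ v = ⊥ := by
    rw [← disjoint_iff, Submodule.disjoint_span_singleton' h0]
    exact hv
  rw [h1, finrank_bot, finrank_span_singleton h0] at h
  omega

theorem exists_between_finrank_eq [FiniteDimensional K V] {X Z : Submodule K V} (hXZ : X ≤ Z)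
    {n : ℕ} (h1 : finrank K X ≤ n) (h2 : n ≤ finrank K Z) :
    ∃ Y, X ≤ Y ∧ Y ≤ Z ∧ finrank K Y = n := by
  induction n, h1 using Nat.le_induction with
  | base => exact ⟨X, le_rfl, hXZ, rfl⟩
  | succ n hn ih =>
    obtain ⟨Y, h3, h4, h5⟩ := ih (by omega)
    have : ∃ v ∈ Z, v ∉ Y := by
      by_contra! h
      have := Submodule.finrank_mono (show Z ≤ Y from h)
      omega
    obtain ⟨v, hv, hvY⟩ := this
    refine ⟨Y ⊔ K ∙ v, h3.trans le_sup_left, sup_le h4 (by simpa using hv), ?_⟩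
    rw [finrank_sup_span_singleton hvY, h5]

theorem exists_le_finrank_eq [FiniteDimensional K V] {Z : Submodule K V} {n : ℕ}
    (h : n ≤ finrank K Z) : ∃ Y ≤ Z, finrank K Y = n := by
  obtain ⟨Y, _, h1, h2⟩ := exists_between_finrank_eq (bot_le : ⊥ ≤ Z) (by simp) h
  exact ⟨Y, h1, h2⟩

/-- A complement of X ∩ A in A has room for A' of dimension dim A - t + 1 with X ∩ A' = 0; take Z =
X + A'. Inside A the dimensions of C ∩ A and A' add up to more than dim A, so C contains a nonzero
vector v of A', and Y = X + ⟨v⟩. -/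
theorem exists_expansion [FiniteDimensional K V] {t : ℕ} {X A : Submodule K V} (ht : t ≤ finrank K A)
    (hXA : finrank K ↥(X ⊓ A) < t) :
    ∃ Z, X ≤ Z ∧ finrank K Z = finrank K X + (finrank K A - t + 1) ∧
      ∀ C, X ≤ C → t ≤ finrank K ↥(C ⊓ A) → ∃ Y ∈ pts X Z, Y ≤ C := by
  obtain ⟨W, hW, hWA⟩ := IsModularLattice.exists_disjoint_and_sup_eq (inf_le_right : X ⊓ A ≤ A)
  have hW1 := Submodule.finrank_sup_add_finrank_inf_eq (X ⊓ A) W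
  rw [hWA, hW.eq_bot, finrank_bot] at hW1
  obtain ⟨A', hA'W, hA'⟩ := exists_le_finrank_eq (show finrank K A - t + 1 ≤ finrank K W by omega)
  have hA'A : A' ≤ A := hA'W.trans (hWA ▸ le_sup_right)
  have hdisj : X ⊓ A' = ⊥ := by
    rw [eq_bot_iff, ← hW.eq_bot]
    exact le_inf (inf_le_inf_left _ hA'A) (inf_le_right.trans hA'W)
  have hsum := Submodule.finrank_sup_add_finrank_inf_eq X A'
  rw [hdisj, finrank_bot, hA'] at hsum
  refine ⟨X ⊔ A', le_sup_left, by omega, fun C hXC hC => ?_⟩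
  have h1 := Submodule.finrank_sup_add_finrank_inf_eq (C ⊓ A) A'
  have h2 := Submodule.finrank_mono (sup_le (inf_le_right : C ⊓ A ≤ A) hA'A)
  have h3 : ((C ⊓ A) ⊓ A' : Submodule K V) ≠ ⊥ := by
    intro h
    rw [h, finrank_bot] at h1
    omega
  obtain ⟨v, hv, hv0⟩ := Submodule.exists_mem_ne_zero_of_ne_bot h3
  have hvX : v ∉ X := fun h => hv0 <| by
    have : v ∈ X ⊓ A' := ⟨h, hv.2⟩
    rwa [hdisj, Submodule.mem_bot] at this
  refine ⟨X ⊔ K ∙ v, ⟨le_sup_left, sup_le_sup_left (by simpa using hv.2) _,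
    finrank_sup_span_singleton hvX⟩, sup_le hXC (by simpa using hv.1.1)⟩

end Subspaces

/-! ### Counting extensions and members through a subspace -/

section Counting

variable {K V : Type*} [Field K] [AddCommGroup V] [Module K V] [Finite V]

theorem natCard_subspace_diff {X Y : Submodule K V} (h : X ≤ Y) :
    ({v | v ∈ Y ∧ v ∉ X} : Set V).ncard = Nat.card K ^ finrank K Y - Nat.card K ^ finrank K X := by
  have h1 : ({v | v ∈ Y ∧ v ∉ X} : Set V) = (Y : Set V) \ X := rfl
  rw [h1, Set.ncard_sdiff (by exact_mod_cast h) (Set.toFinite _)]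
  congr 1 <;> exact Module.natCard_eq_pow_finrank

theorem two_le_card [Finite K] : (2 : ℝ) ≤ (Nat.card K : ℝ) := by
  exact_mod_cast Finite.one_lt_card (α := K)

/-- Sort the vectors v of Z outside X by X + ⟨v⟩. With k = dim X, each fibre has q^(k+1) - q^k
elements. -/
theorem ncard_pts [Finite K] {X Z : Submodule K V} (hXZ : X ≤ Z) :
    ((pts X Z).ncard : ℝ) = qNum (Nat.card K) (finrank K Z - finrank K X) := by
  classical
  have := Fintype.ofFinite V
  have := Fintype.ofFinite (Submodule K V)
  set q := Nat.card K with hq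
  have hq2 : (2 : ℝ) ≤ q := two_le_card
  set S : Finset V := Finset.univ.filter fun v => v ∈ Z ∧ v ∉ X
  set T : Finset (Submodule K V) := Finset.univ.filter fun Y => Y ∈ pts X Z
  have hT : (pts X Z).ncard = T.card := by
    rw [← Set.ncard_coe_finset]; congr 1; ext; simp [T]
  have hS : S.card = q ^ finrank K Z - q ^ finrank K X := by
    rw [← natCard_subspace_diff hXZ, ← Set.ncard_coe_finset]; congr 1; ext; simp [S]
  have hmaps : Set.MapsTo (fun v => X ⊔ K ∙ v) (S : Set V) (T : Set (Submodule K V)) := by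
    intro v hv
    simp only [S, Finset.coe_filter, Finset.mem_univ, true_and, Set.mem_ofPred_eq] at hv
    simp only [T, Finset.coe_filter, Finset.mem_univ, true_and, Set.mem_ofPred_eq]
    exact ⟨le_sup_left, sup_le hXZ (by simpa using hv.1), finrank_sup_span_singleton hv.2⟩
  have hcard := Finset.card_eq_sum_card_fiberwise hmaps
  have hfib : ∀ Y ∈ T, (S.filter fun v => X ⊔ K ∙ v = Y).card
      = q ^ (finrank K X + 1) - q ^ finrank K X := by
    intro Y hY
    simp only [T, Finset.mem_filter, Finset.mem_univ, true_and] at hY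
    obtain ⟨h1, h2, h3⟩ := hY
    rw [← h3, ← natCard_subspace_diff h1, ← Set.ncard_coe_finset]
    congr 1
    ext v
    simp only [S, Finset.coe_filter, Finset.mem_filter, Finset.mem_univ, true_and,
      Set.mem_ofPred_eq]
    constructor
    · rintro ⟨⟨_, hX⟩, rfl⟩
      exact ⟨(le_sup_right : K ∙ v ≤ X ⊔ K ∙ v) (Submodule.mem_span_singleton_self v), hX⟩
    · rintro ⟨hY, hX⟩
      refine ⟨⟨h2 hY, hX⟩, Submodule.eq_of_le_of_finrank_eq (sup_le h1 (by simpa using hY)) ?_⟩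
      rw [finrank_sup_span_singleton hX, h3]
  rw [Finset.sum_congr rfl hfib, Finset.sum_const, smul_eq_mul, hS] at hcard
  have hq1 : 1 ≤ q := by exact_mod_cast (by linarith : (1 : ℝ) ≤ q)
  have hle := Submodule.finrank_mono hXZ
  obtain ⟨d, hd⟩ := Nat.exists_eq_add_of_le hle
  have hR : (q : ℝ) ^ finrank K Z - (q : ℝ) ^ finrank K X
      = T.card * ((q : ℝ) ^ (finrank K X + 1) - (q : ℝ) ^ finrank K X) := by
    have := congrArg (Nat.cast : ℕ → ℝ) hcard
    rw [Nat.cast_sub (Nat.pow_le_pow_right hq1 hle), Nat.cast_mul,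
      Nat.cast_sub (Nat.pow_le_pow_right hq1 (Nat.le_succ _))] at this
    exact_mod_cast this
  rw [hT, hd, Nat.add_sub_cancel_left]
  rw [hd, pow_add, pow_succ] at hR
  have hne : (q : ℝ) ^ finrank K X ≠ 0 := by positivity
  have hR' : (q : ℝ) ^ d - 1 = T.card * (q - 1) := by
    apply mul_left_cancel₀ hne
    linear_combination hR
  rw [← sub_one_mul_qNum] at hR'
  have : (q : ℝ) - 1 ≠ 0 := by linarith
  apply mul_left_cancel₀ this
  linear_combination -hR'

/-- The members of a family that contain a given subspace. -/
def star (𝒢 : Set (Submodule K V)) (X : Submodule K V) : Set (Submodule K V) := {F ∈ 𝒢 | X ≤ F}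

/-- Double count the flags X < Y ≤ F with Y one dimension above X. This is the induction step of all
exact counts below. -/
theorem ncard_star_mul_qNum [Finite K] {m : ℕ} {𝒢 : Set (Submodule K V)} {X Z : Submodule K V}
    (hm : ∀ F ∈ 𝒢, finrank K F = m) (hZ : ∀ F ∈ 𝒢, X ≤ F → F ≤ Z) :
    ((star 𝒢 X).ncard : ℝ) * qNum (Nat.card K) (m - finrank K X)
      = ∑ Y ∈ (Set.toFinite (pts X Z)).toFinset, ((star 𝒢 Y).ncard : ℝ) := by
  classical
  have := Fintype.ofFinite (Submodule K V)
  set S : Finset (Submodule K V) := (star 𝒢 X).toFinset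
  set T : Finset (Submodule K V) := (Set.toFinite (pts X Z)).toFinset
  have hSm : ∀ F, F ∈ S ↔ F ∈ star 𝒢 X := fun F => Set.mem_toFinset
  have hTm : ∀ Y, Y ∈ T ↔ Y ∈ pts X Z := fun Y => Set.Finite.mem_toFinset _
  have h := Finset.sum_card_bipartiteAbove_eq_sum_card_bipartiteBelow
    (fun (F Y : Submodule K V) => Y ≤ F) (s := S) (t := T)
  have h1 : ∀ F ∈ S, ((T.bipartiteAbove (fun (F Y : Submodule K V) => Y ≤ F) F).card : ℝ)
      = qNum (Nat.card K) (m - finrank K X) := by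
    intro F hF
    rw [hSm] at hF
    rw [← hm F hF.1, ← ncard_pts hF.2, ← Set.ncard_coe_finset]
    congr 2
    ext Y
    simp only [Finset.coe_bipartiteAbove, hTm, Set.mem_ofPred_eq]
    simp only [pts, Set.mem_ofPred_eq]
    have := hZ F hF.1 hF.2
    exact ⟨fun h => ⟨h.1.1, h.2, h.1.2.2⟩, fun h => ⟨⟨h.1, h.2.1.trans this, h.2.2⟩, h.2.1⟩⟩
  have h2 : ∀ Y ∈ T, ((S.bipartiteBelow (fun (F Y : Submodule K V) => Y ≤ F) Y).card : ℝ)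
      = ((star 𝒢 Y).ncard : ℝ) := by
    intro Y hY
    rw [hTm] at hY
    rw [← Set.ncard_coe_finset]
    congr 2
    ext F
    simp only [Finset.coe_bipartiteBelow, hSm, Set.mem_ofPred_eq]
    simp only [star, Set.mem_ofPred_eq]
    exact ⟨fun h => ⟨h.1.1, h.2⟩, fun h => ⟨⟨h.1, hY.1.trans h.2⟩, h.2⟩⟩
  have h3 := congrArg (Nat.cast : ℕ → ℝ) h
  push_cast at h3
  rw [Finset.sum_congr rfl h1, Finset.sum_congr rfl h2, Finset.sum_const, nsmul_eq_mul] at h3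
  rw [Set.ncard_eq_toFinset_card']
  exact h3

theorem sum_pts_const [Finite K] {X Z : Submodule K V} (hXZ : X ≤ Z) (c : ℝ) :
    ∑ _Y ∈ (Set.toFinite (pts X Z)).toFinset, c
      = qNum (Nat.card K) (finrank K Z - finrank K X) * c := by
  rw [Finset.sum_const, nsmul_eq_mul, ← ncard_pts hXZ, Set.ncard_eq_toFinset_card]

theorem ncard_le_of_forall_exists {𝒢 I : Set (Submodule K V)} {c : ℝ}
    (h : ∀ F ∈ 𝒢, ∃ Y ∈ I, Y ≤ F) (hc : ∀ Y ∈ I, ((star 𝒢 Y).ncard : ℝ) ≤ c) :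
    (𝒢.ncard : ℝ) ≤ I.ncard * c := by
  classical
  have := Fintype.ofFinite (Submodule K V)
  have h1 : 𝒢 ⊆ ⋃ Y ∈ I.toFinset, star 𝒢 Y := by
    intro F hF
    obtain ⟨Y, hY, hle⟩ := h F hF
    simp only [Set.mem_iUnion]
    exact ⟨Y, by simpa using hY, hF, hle⟩
  have h2 : 𝒢.ncard ≤ ∑ Y ∈ I.toFinset, (star 𝒢 Y).ncard :=
    (Set.ncard_le_ncard h1 (Set.toFinite _)).trans (Finset.set_ncard_biUnion_le _ _)
  calc (𝒢.ncard : ℝ) ≤ ∑ Y ∈ I.toFinset, ((star 𝒢 Y).ncard : ℝ) := by exact_mod_cast h2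
    _ ≤ ∑ Y ∈ I.toFinset, c := Finset.sum_le_sum fun Y hY => hc Y (by simpa using hY)
    _ = I.ncard * c := by rw [Finset.sum_const, nsmul_eq_mul, Set.ncard_eq_toFinset_card']

end Counting

/-! ### Totally isotropic subspaces through a given one -/

section IsotropicCount

/-- The number of `m`-dimensional totally isotropic subspaces containing a given `k`-dimensional
one, in a symplectic space of dimension `2 * ν`. -/
noncomputable def isoNum (q : ℝ) (ν k m : ℕ) : ℝ :=
  if k ≤ m then ∏ i ∈ Finset.Ico k m, qNum q (2 * (ν - i)) / qNum q (m - i) else 0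

theorem isoNum_self (q : ℝ) (ν m : ℕ) : isoNum q ν m m = 1 := by simp [isoNum]

theorem isoNum_of_lt (q : ℝ) (ν : ℕ) {k m : ℕ} (h : m < k) : isoNum q ν k m = 0 := by
  simp [isoNum, h]

theorem isoNum_nonneg {q : ℝ} (hq : 2 ≤ q) (ν k m : ℕ) : 0 ≤ isoNum q ν k m := by
  unfold isoNum
  split_ifs
  · exact Finset.prod_nonneg fun i _ => div_nonneg (qNum_nonneg hq _) (qNum_nonneg hq _)
  · exact le_rfl

theorem isoNum_pos {q : ℝ} (hq : 2 ≤ q) {ν k m : ℕ} (hkm : k ≤ m) (hm : m ≤ ν) :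
    0 < isoNum q ν k m := by
  rw [isoNum, if_pos hkm]
  refine Finset.prod_pos fun i hi => ?_
  rw [Finset.mem_Ico] at hi
  exact div_pos (qNum_pos hq (by omega)) (qNum_pos hq (by omega))

/-- The recurrence through which later estimates use `isoNum`. For k ≥ m both sides vanish. -/
theorem isoNum_mul_qNum {q : ℝ} (hq : 2 ≤ q) (ν k m : ℕ) :
    isoNum q ν k m * qNum q (m - k) = qNum q (2 * (ν - k)) * isoNum q ν (k + 1) m := by
  rcases lt_trichotomy k m with h | rfl | h
  · rw [isoNum, if_pos h.le, isoNum, if_pos (by omega : k + 1 ≤ m),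
      Finset.prod_eq_prod_Ico_succ_bot h]
    have := (qNum_pos hq (show 1 ≤ m - k by omega)).ne'
    field_simp
  · simp [qNum_zero, isoNum_of_lt]
  · rw [isoNum_of_lt _ _ h, isoNum_of_lt _ _ (by omega : m < k + 1)]
    ring

variable {K V : Type*} [Field K] [AddCommGroup V] [Module K V]
  {B : LinearMap.BilinForm K V}

theorem IsTotallyIsotropic.mono {X Y : Submodule K V} (h : X ≤ Y) (hY : IsTotallyIsotropic B Y) :
    IsTotallyIsotropic B X :=
  fun x hx y hy => hY x (h hx) y (h hy)

theorem IsTotallyIsotropic.le_orthogonal {X Y : Submodule K V} (h : X ≤ Y)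
    (hY : IsTotallyIsotropic B Y) : Y ≤ B.orthogonal X :=
  fun y hy x hx => hY x (h hx) y hy

theorem mem_isotropicSubspaces_of_le {m k : ℕ} {F X : Submodule K V}
    (hF : F ∈ isotropicSubspaces B m) (hX : X ≤ F) (hk : finrank K X = k) :
    X ∈ isotropicSubspaces B k :=
  ⟨hF.1.mono hX, hk⟩

variable [Finite V]

/-- Y = X + ⟨v⟩ with v orthogonal to X, and B(v, v) = 0 because B is alternating. -/
theorem IsTotallyIsotropic.of_mem_pts (hB : B.IsAlt) {X Y : Submodule K V}
    (hX : IsTotallyIsotropic B X) (hY : Y ∈ pts X (B.orthogonal X)) : IsTotallyIsotropic B Y := by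
  obtain ⟨h1, h2, h3⟩ := hY
  have : ∃ v ∈ Y, v ∉ X := by
    by_contra! h
    have := Submodule.finrank_mono (show Y ≤ X from h)
    omega
  obtain ⟨v, hv, hvX⟩ := this
  have hYe : X ⊔ K ∙ v = Y := Submodule.eq_of_le_of_finrank_eq (sup_le h1 (by simpa using hv))
    (by rw [finrank_sup_span_singleton hvX, h3])
  have hXv : ∀ x ∈ X, B x v = 0 := fun x hx => h2 hv x hx
  have hvX' : ∀ x ∈ X, B v x = 0 := fun x hx => hB.isRefl _ _ (hXv x hx)
  intro x hx y hy
  rw [← hYe, Submodule.mem_sup] at hx hy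
  obtain ⟨x₁, hx₁, x₂, hx₂, rfl⟩ := hx
  obtain ⟨y₁, hy₁, y₂, hy₂, rfl⟩ := hy
  obtain ⟨r, rfl⟩ := Submodule.mem_span_singleton.1 hx₂
  obtain ⟨s, rfl⟩ := Submodule.mem_span_singleton.1 hy₂
  simp [hX x₁ hx₁ y₁ hy₁, hXv x₁ hx₁, hvX' y₁ hy₁, hB v]

variable [Finite K]

/-- Members through X lie in X^⊥, and every one-dimensional extension of X inside X^⊥ is again
isotropic. There are [2ν - 2k] of them, so flag counting reproduces the recurrence of `isoNum`. -/
theorem ncard_star_isotropicSubspaces (hB : B.IsAlt) (hN : B.Nondegenerate) {ν k m : ℕ}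
    (hV : finrank K V = 2 * ν) {X : Submodule K V} (hX : X ∈ isotropicSubspaces B k) :
    ((star (isotropicSubspaces B m) X).ncard : ℝ) = isoNum (Nat.card K) ν k m := by
  have hq : (2 : ℝ) ≤ Nat.card K := two_le_card
  rcases lt_or_ge m k with hmk | hmk
  · rw [isoNum_of_lt _ _ hmk]
    have : star (isotropicSubspaces B m) X = ∅ := by
      ext F
      simp only [star, Set.mem_ofPred_eq, Set.mem_empty_iff_false, iff_false]
      rintro ⟨hF, hXF⟩
      have := Submodule.finrank_mono hXF
      rw [hX.2, hF.2] at this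
      omega
    simp [this]
  · obtain ⟨d, rfl⟩ := Nat.exists_eq_add_of_le hmk
    clear hmk
    induction d generalizing k X with
    | zero =>
      have : star (isotropicSubspaces B (k + 0)) X = {X} := by
        ext F
        simp only [star, Set.mem_ofPred_eq, Set.mem_singleton_iff]
        constructor
        · rintro ⟨hF, hXF⟩
          exact (Submodule.eq_of_le_of_finrank_eq hXF (by rw [hX.2, hF.2]; rfl)).symm
        · rintro rfl
          exact ⟨hX, le_rfl⟩
      rw [this]
      simp [isoNum_self]
    | succ d ih =>
      have h := ncard_star_mul_qNum (𝒢 := isotropicSubspaces B (k + (d + 1))) (X := X)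
        (Z := B.orthogonal X) (fun F hF => hF.2) (fun F hF hXF => hF.1.le_orthogonal hXF)
      have hc : ∀ Y ∈ (Set.toFinite (pts X (B.orthogonal X))).toFinset,
          ((star (isotropicSubspaces B (k + (d + 1))) Y).ncard : ℝ)
            = isoNum (Nat.card K) ν (k + 1) (k + (d + 1)) := by
        intro Y hY
        rw [Set.Finite.mem_toFinset] at hY
        rw [show k + (d + 1) = k + 1 + d by omega]
        exact ih ⟨hX.1.of_mem_pts hB hY, by rw [hY.2.2, hX.2]⟩
      rw [Finset.sum_congr rfl hc, sum_pts_const (hX.1.le_orthogonal le_rfl),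
        LinearMap.BilinForm.finrank_orthogonal hN, hV, hX.2,
        show 2 * ν - k - k = 2 * (ν - k) by omega, ← isoNum_mul_qNum hq] at h
      exact mul_right_cancel₀ (qNum_pos hq (by omega)).ne' h

/-- Isotropy of X need not be assumed: otherwise no member contains X. -/
theorem ncard_star_le_isoNum (hB : B.IsAlt) (hN : B.Nondegenerate) {ν k m : ℕ}
    (hV : finrank K V = 2 * ν) {𝒢 : Set (Submodule K V)} (h𝒢 : 𝒢 ⊆ isotropicSubspaces B m)
    {X : Submodule K V} (hX : finrank K X = k) :
    ((star 𝒢 X).ncard : ℝ) ≤ isoNum (Nat.card K) ν k m := by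
  by_cases h : IsTotallyIsotropic B X
  · rw [← ncard_star_isotropicSubspaces hB hN hV
      (show X ∈ isotropicSubspaces B k from ⟨h, hX⟩)]
    have hs : star 𝒢 X ⊆ star (isotropicSubspaces B m) X := fun F hF => ⟨h𝒢 hF.1, hF.2⟩
    exact_mod_cast Set.ncard_le_ncard hs (Set.toFinite _)
  · have : star 𝒢 X = ∅ := by
      ext F
      simp only [star, Set.mem_ofPred_eq, Set.mem_empty_iff_false, iff_false]
      rintro ⟨hF, hXF⟩
      exact h ((h𝒢 hF).1.mono hXF)
    rw [this, Set.ncard_empty, Nat.cast_zero]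
    exact isoNum_nonneg two_le_card _ _ _

end IsotropicCount

/-! ### Bounds for Gaussian binomial coefficients -/

section SubspaceCount

variable {K V : Type*} [Field K] [AddCommGroup V] [Module K V]

/-- The `n`-dimensional subspaces of `S`. -/
def subspacesIn (S : Submodule K V) (n : ℕ) : Set (Submodule K V) := {W | W ≤ S ∧ finrank K W = n}

/-- Drives the bound [t+1]^e for the number of t-subspaces of a (t+e)-space. It iterates [t+e+1]·[t]
≤ [t+e]·[t+1]. -/
theorem qNum_mul_pow_le {q : ℝ} (hq : 2 ≤ q) (t e : ℕ) :
    qNum q (t + e) * qNum q t ^ e ≤ qNum q t * qNum q (t + 1) ^ e := by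
  induction e with
  | zero => simp
  | succ e ih =>
    have h1 : qNum q (t + (e + 1)) * qNum q t ≤ qNum q (t + e) * qNum q (t + 1) := by
      rw [← add_assoc, qNum_succ, qNum_succ]
      nlinarith [qNum_mono hq (show t ≤ t + e by omega)]
    have h2 := pow_nonneg (qNum_nonneg hq t) e
    have h3 := qNum_nonneg hq (t + 1)
    calc qNum q (t + (e + 1)) * qNum q t ^ (e + 1)
        = qNum q (t + (e + 1)) * qNum q t * qNum q t ^ e := by ring
      _ ≤ qNum q (t + e) * qNum q (t + 1) * qNum q t ^ e := by gcongr
      _ = qNum q (t + e) * qNum q t ^ e * qNum q (t + 1) := by ring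
      _ ≤ qNum q t * qNum q (t + 1) ^ e * qNum q (t + 1) := by gcongr
      _ = _ := by ring

variable [Finite V]

theorem star_subspacesIn_self {S X : Submodule K V} (hX : X ≤ S) {t : ℕ} (ht : finrank K X = t) :
    star (subspacesIn S t) X = {X} := by
  ext F
  simp only [star, subspacesIn, Set.mem_ofPred_eq, Set.mem_singleton_iff]
  constructor
  · rintro ⟨hF, hXF⟩
    exact (Submodule.eq_of_le_of_finrank_eq hXF (by rw [ht, hF.2])).symm
  · rintro rfl
    exact ⟨⟨hX, ht⟩, le_rfl⟩

variable [Finite K]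

theorem ncard_star_subspacesIn_le {S X : Submodule K V} (hX : X ≤ S) {t : ℕ}
    (hXt : finrank K X ≤ t) (ht : t ≤ finrank K S) :
    ((star (subspacesIn S t) X).ncard : ℝ)
      ≤ qNum (Nat.card K) (t - finrank K X + 1) ^ (finrank K S - t) := by
  have hq : (2 : ℝ) ≤ Nat.card K := two_le_card
  obtain ⟨d, rfl⟩ := Nat.exists_eq_add_of_le hXt
  clear hXt
  generalize hk : finrank K X = k at ht ⊢
  induction d generalizing k X with
  | zero =>
    rw [star_subspacesIn_self hX (by rw [hk]; rfl)]
    simp [qNum_one]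
  | succ d ih =>
    have h := ncard_star_mul_qNum (𝒢 := subspacesIn S (k + (d + 1))) (X := X)
      (Z := S) (fun F hF => hF.2) (fun F hF _ => hF.1)
    have hc : ∀ Y ∈ (Set.toFinite (pts X S)).toFinset,
        ((star (subspacesIn S (k + (d + 1))) Y).ncard : ℝ)
          ≤ qNum (Nat.card K) (d + 1) ^ (finrank K S - (k + (d + 1))) := by
      intro Y hY
      rw [Set.Finite.mem_toFinset] at hY
      have := ih hY.2.1 (k + 1) (by rw [hY.2.2, hk]) (by omega)
      rwa [show k + 1 + d = k + (d + 1) by omega,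
        show k + (d + 1) - (k + 1) + 1 = d + 1 by omega] at this
    have h2 := Finset.sum_le_sum hc
    rw [← h, sum_pts_const hX, hk, Nat.add_sub_cancel_left] at h2
    rw [Nat.add_sub_cancel_left]
    set e := finrank K S - (k + (d + 1))
    rw [show finrank K S - k = d + 1 + e by omega] at h2
    have h3 := h2.trans (qNum_mul_pow_le hq (d + 1) e)
    rw [mul_comm] at h3
    exact le_of_mul_le_mul_left h3 (qNum_pos hq (by omega))

theorem ncard_subspacesIn_le {S : Submodule K V} {t : ℕ} (ht : t ≤ finrank K S) :
    ((subspacesIn S t).ncard : ℝ) ≤ qNum (Nat.card K) (t + 1) ^ (finrank K S - t) := by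
  have h := ncard_star_subspacesIn_le (bot_le : ⊥ ≤ S) (t := t) (by simp) ht
  simpa [star] using h

theorem ncard_star_subspacesIn {S X : Submodule K V} (hX : X ≤ S) {t : ℕ}
    (hXt : finrank K X ≤ t) (ht : finrank K S = t + 1) :
    ((star (subspacesIn S t) X).ncard : ℝ) = qNum (Nat.card K) (t + 1 - finrank K X) := by
  have hq : (2 : ℝ) ≤ Nat.card K := two_le_card
  obtain ⟨d, rfl⟩ := Nat.exists_eq_add_of_le hXt
  clear hXt
  generalize hk : finrank K X = k at ht ⊢
  induction d generalizing k X with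
  | zero =>
    rw [star_subspacesIn_self hX (by rw [hk]; rfl)]
    simp [qNum_one]
  | succ d ih =>
    have h := ncard_star_mul_qNum (𝒢 := subspacesIn S (k + (d + 1))) (X := X)
      (Z := S) (fun F hF => hF.2) (fun F hF _ => hF.1)
    have hc : ∀ Y ∈ (Set.toFinite (pts X S)).toFinset,
        ((star (subspacesIn S (k + (d + 1))) Y).ncard : ℝ) = qNum (Nat.card K) (d + 1) := by
      intro Y hY
      rw [Set.Finite.mem_toFinset] at hY
      have := ih hY.2.1 (k + 1) (by rw [hY.2.2, hk]) (by omega)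
      rwa [show k + 1 + d = k + (d + 1) by omega,
        show k + (d + 1) + 1 - (k + 1) = d + 1 by omega] at this
    rw [Finset.sum_congr rfl hc, sum_pts_const hX, hk, Nat.add_sub_cancel_left, ht] at h
    exact mul_right_cancel₀ (qNum_pos hq (by omega)).ne' h

theorem ncard_subspacesIn {S : Submodule K V} {t : ℕ} (ht : finrank K S = t + 1) :
    ((subspacesIn S t).ncard : ℝ) = qNum (Nat.card K) (t + 1) := by
  have h := ncard_star_subspacesIn (bot_le : ⊥ ≤ S) (t := t) (by simp) ht
  simpa [star] using h

end SubspaceCount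

/-! ### First and second moments of incidence counts -/

section IncidenceSums

variable {K V : Type*} [Field K] [AddCommGroup V] [Module K V] [Finite V]

open Classical in
theorem ncard_filter_le_eq_sum (I : Set (Submodule K V)) (F : Submodule K V) :
    (({Y ∈ I | Y ≤ F}).ncard : ℝ)
      = ∑ Y ∈ (Set.toFinite I).toFinset, if Y ≤ F then (1 : ℝ) else 0 := by
  rw [Finset.sum_boole, ← Set.ncard_coe_finset]
  congr 2
  ext Y
  simp

open Classical in
theorem ncard_star_eq_sum (𝒢 : Set (Submodule K V)) (Y : Submodule K V) :
    ((star 𝒢 Y).ncard : ℝ)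
      = ∑ F ∈ (Set.toFinite 𝒢).toFinset, if Y ≤ F then (1 : ℝ) else 0 := by
  rw [Finset.sum_boole, ← Set.ncard_coe_finset]
  congr 2
  ext Y
  simp [star]

theorem sum_ncard_filter_le (I 𝒢 : Set (Submodule K V)) :
    ∑ F ∈ (Set.toFinite 𝒢).toFinset, (({Y ∈ I | Y ≤ F}).ncard : ℝ)
      = ∑ Y ∈ (Set.toFinite I).toFinset, ((star 𝒢 Y).ncard : ℝ) := by
  simp only [ncard_filter_le_eq_sum, ncard_star_eq_sum]
  exact Finset.sum_comm

/-- The square counts ordered pairs (Y, Y') below F, and both lie below F exactly when Y ⊔ Y' does.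
-/
theorem sum_ncard_filter_le_sq (I 𝒢 : Set (Submodule K V)) :
    ∑ F ∈ (Set.toFinite 𝒢).toFinset, (({Y ∈ I | Y ≤ F}).ncard : ℝ) ^ 2
      = ∑ Y ∈ (Set.toFinite I).toFinset, ∑ Y' ∈ (Set.toFinite I).toFinset,
          ((star 𝒢 (Y ⊔ Y')).ncard : ℝ) := by
  classical
  simp only [ncard_filter_le_eq_sum, ncard_star_eq_sum, sq, Finset.sum_mul_sum]
  rw [Finset.sum_comm]
  refine Finset.sum_congr rfl fun Y _ => ?_
  rw [Finset.sum_comm]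
  refine Finset.sum_congr rfl fun Y' _ => Finset.sum_congr rfl fun F _ => ?_
  by_cases h : Y ≤ F <;> by_cases h' : Y' ≤ F <;> simp [h, h']

theorem ncard_eq_sum_ite {𝒢 ℋ : Set (Submodule K V)} (h : ℋ ⊆ 𝒢) [DecidablePred (· ∈ ℋ)] :
    (ℋ.ncard : ℝ) = ∑ F ∈ (Set.toFinite 𝒢).toFinset, if F ∈ ℋ then (1 : ℝ) else 0 := by
  rw [Finset.sum_boole, ← Set.ncard_coe_finset]
  congr 2
  ext Y
  simpa using fun hY => h hY

theorem finrank_sup_of_mem_pts {X Z Y Y' : Submodule K V} (hY : Y ∈ pts X Z) (hY' : Y' ∈ pts X Z)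
    (hne : Y ≠ Y') : finrank K ↥(Y ⊔ Y') = finrank K X + 2 := by
  have h1 := Submodule.finrank_sup_add_finrank_inf_eq Y Y'
  have h2 := Submodule.finrank_mono (le_inf hY.1 hY'.1)
  have h3 := hY.2.2
  have h4 := hY'.2.2
  have h5 : finrank K ↥(Y ⊓ Y') ≠ finrank K X + 1 := fun h => hne <| by
    have e1 := Submodule.eq_of_le_of_finrank_eq (inf_le_left : Y ⊓ Y' ≤ Y) (by rw [h, h3])
    have e2 := Submodule.eq_of_le_of_finrank_eq (inf_le_right : Y ⊓ Y' ≤ Y') (by rw [h, h4])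
    exact e1.symm.trans e2
  have h6 := Submodule.finrank_mono (inf_le_left : Y ⊓ Y' ≤ Y)
  omega

end IncidenceSums

/-! ### Sizes of the four extremal families -/

section ExplicitFamilies

variable {K V : Type*} [Field K] [AddCommGroup V] [Module K V] [Finite V]
  {B : LinearMap.BilinForm K V} {ν t : ℕ}

theorem star_C₁_of_mem_pts {m : ℕ} {M T Y : Submodule K V}
    (hT : finrank K T = t) (hY : Y ∈ pts T M) :
    star (isotropicSubspaces B m) Y ⊆ C₁ B M T m t := by
  rintro F ⟨hF, hYF⟩
  refine ⟨hF, hY.1.trans hYF, ?_⟩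
  rw [← hT, ← hY.2.2]
  exact Submodule.finrank_mono (le_inf hYF hY.2.1)

theorem exists_mem_pts_of_mem_C₁ {m : ℕ} {M T F : Submodule K V}
    (hT : finrank K T = t) (hTM : T ≤ M) (hF : F ∈ C₁ B M T m t) : ∃ Y ∈ pts T M, Y ≤ F := by
  obtain ⟨Y, h1, h2, h3⟩ := exists_between_finrank_eq (le_inf hF.2.1 hTM) (n := t + 1)
    (by omega) hF.2.2
  exact ⟨Y, ⟨h1, h2.trans inf_le_right, by omega⟩, h2.trans inf_le_left⟩

variable [Finite K]

local notation "𝔮" => ((Nat.card K : ℕ) : ℝ)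

theorem ncard_C₃ (hB : B.IsAlt) (hN : B.Nondegenerate) (hV : finrank K V = 2 * ν) {m : ℕ}
    {S : Submodule K V} (hS : S ∈ isotropicSubspaces B (t + 1)) :
    ((C₃ B S m).ncard : ℝ) = isoNum 𝔮 ν (t + 1) m :=
  ncard_star_isotropicSubspaces hB hN hV hS

/-- Count pairs W ≤ F with W a t-subspace of S. A member F contains only W = F ∩ S, unless S ≤ F,
when it contains all [t+1] = 1 + q[t] of them. -/
theorem ncard_C₄ (hB : B.IsAlt) (hN : B.Nondegenerate) (hV : finrank K V = 2 * ν) {m : ℕ}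
    {S : Submodule K V} (hS : S ∈ isotropicSubspaces B (t + 1)) :
    ((C₄ B S m t).ncard : ℝ)
      = qNum 𝔮 (t + 1) * isoNum 𝔮 ν t m - 𝔮 * qNum 𝔮 t * isoNum 𝔮 ν (t + 1) m := by
  classical
  have h := sum_ncard_filter_le (subspacesIn S t) (C₄ B S m t)
  have h1 : ∀ W ∈ (Set.toFinite (subspacesIn S t)).toFinset,
      ((star (C₄ B S m t) W).ncard : ℝ) = isoNum 𝔮 ν t m := by
    intro W hW
    rw [Set.Finite.mem_toFinset] at hW
    rw [← ncard_star_isotropicSubspaces hB hN hV (mem_isotropicSubspaces_of_le hS hW.1 hW.2)]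
    congr 2
    ext F
    simp only [star, C₄, Set.mem_ofPred_eq]
    refine ⟨fun h => ⟨h.1.1, h.2⟩, fun h => ⟨⟨h.1, ?_⟩, h.2⟩⟩
    rw [← hW.2]
    exact Submodule.finrank_mono (le_inf h.2 hW.1)
  have h2 : ∀ F ∈ (Set.toFinite (C₄ B S m t)).toFinset,
      (({W ∈ subspacesIn S t | W ≤ F}).ncard : ℝ)
        = 1 + 𝔮 * qNum 𝔮 t * if S ≤ F then 1 else 0 := by
    intro F hF
    rw [Set.Finite.mem_toFinset] at hF
    by_cases hSF : S ≤ F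
    · have : {W ∈ subspacesIn S t | W ≤ F} = subspacesIn S t := by
        ext W
        simp only [Set.mem_ofPred_eq, and_iff_left_iff_imp]
        exact fun hW => hW.1.trans hSF
      rw [this, ncard_subspacesIn hS.2, qNum_succ, if_pos hSF]
      ring
    · have hd : finrank K ↥(F ⊓ S) = t := by
        refine le_antisymm ?_ hF.2
        by_contra! hlt
        have := Submodule.eq_of_le_of_finrank_le (inf_le_right : F ⊓ S ≤ S)
          (by rw [hS.2]; exact hlt)
        exact hSF (inf_eq_right.1 this)
      have : {W ∈ subspacesIn S t | W ≤ F} = {F ⊓ S} := by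
        ext W
        simp only [Set.mem_ofPred_eq, Set.mem_singleton_iff]
        constructor
        · rintro ⟨⟨h1, h2⟩, h3⟩
          exact Submodule.eq_of_le_of_finrank_eq (le_inf h3 h1) (by rw [h2, hd])
        · rintro rfl
          exact ⟨⟨inf_le_right, hd⟩, inf_le_left⟩
      rw [this, if_neg hSF]
      simp
  have h3 : star (C₄ B S m t) S = star (isotropicSubspaces B m) S := by
    ext F
    simp only [star, C₄, Set.mem_ofPred_eq]
    refine ⟨fun h => ⟨h.1.1, h.2⟩, fun h => ⟨⟨h.1, ?_⟩, h.2⟩⟩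
    rw [inf_eq_right.2 h.2, hS.2]
    omega
  rw [Finset.sum_congr rfl h1, Finset.sum_congr rfl h2, Finset.sum_add_distrib, ← Finset.mul_sum,
    ← ncard_star_eq_sum, h3, ncard_star_isotropicSubspaces hB hN hV hS, Finset.sum_const,
    Finset.sum_const, nsmul_eq_mul, nsmul_eq_mul, ← Set.ncard_eq_toFinset_card,
    ← Set.ncard_eq_toFinset_card, ncard_subspacesIn hS.2] at h
  linarith

/-- C₁ is the union of the stars of the [b-t+1] extensions Y of T in M. Fix one, Y₀; each of the
other q[b-t] stars shares with it the members through Y ⊔ Y₀, which are counted only once. -/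
theorem ncard_C₁_le (hB : B.IsAlt) (hN : B.Nondegenerate) (hV : finrank K V = 2 * ν) {m b : ℕ}
    {M T : Submodule K V} (hM : M ∈ isotropicSubspaces B (b + 1))
    (hT : T ∈ isotropicSubspaces B t) (hTM : T ≤ M) (htb : t ≤ b) :
    ((C₁ B M T m t).ncard : ℝ) ≤ qNum 𝔮 (b - t + 1) * isoNum 𝔮 ν (t + 1) m
      - 𝔮 * qNum 𝔮 (b - t) * isoNum 𝔮 ν (t + 2) m := by
  classical
  obtain ⟨Y₀, h1, h2, h3⟩ := exists_between_finrank_eq hTM (n := t + 1)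
    (by rw [hT.2]; omega) (by rw [hM.2]; omega)
  have hY₀ : Y₀ ∈ pts T M := ⟨h1, h2, by rw [h3, hT.2]⟩
  set P := isotropicSubspaces B m
  have hiso : ∀ Y ∈ pts T M, ((star P Y).ncard : ℝ) = isoNum 𝔮 ν (t + 1) m := fun Y hY =>
    ncard_star_isotropicSubspaces hB hN hV
      (mem_isotropicSubspaces_of_le hM hY.2.1 (by rw [hY.2.2, hT.2]))
  set I := (Set.toFinite (pts T M)).toFinset.erase Y₀
  have hsub : C₁ B M T m t ⊆ star P Y₀ ∪ ⋃ Y ∈ I, (star P Y \ star P Y₀) := by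
    intro F hF
    obtain ⟨Y, hY, hYF⟩ := exists_mem_pts_of_mem_C₁ hT.2 hTM hF
    by_cases h : Y₀ ≤ F
    · exact Or.inl ⟨hF.1, h⟩
    · refine Or.inr (Set.mem_biUnion (x := Y) ?_ ⟨⟨hF.1, hYF⟩, fun h' => h h'.2⟩)
      simp only [I, Finset.coe_erase, Set.Finite.coe_toFinset]
      refine ⟨hY, ?_⟩
      rintro rfl
      exact h hYF
  have hI : ∀ Y ∈ I, ((star P Y \ star P Y₀).ncard : ℝ)
      = isoNum 𝔮 ν (t + 1) m - isoNum 𝔮 ν (t + 2) m := by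
    intro Y hY
    simp only [I, Finset.mem_erase, Set.Finite.mem_toFinset] at hY
    have e : star P Y ∩ star P Y₀ = star P (Y ⊔ Y₀) := by
      ext F
      simp only [star, Set.mem_inter_iff, Set.mem_ofPred_eq, sup_le_iff]
      tauto
    have e1 := Set.ncard_inter_add_ncard_sdiff_eq_ncard (star P Y) (star P Y₀) (Set.toFinite _)
    have e2 : ((star P (Y ⊔ Y₀)).ncard : ℝ) = isoNum 𝔮 ν (t + 2) m :=
      ncard_star_isotropicSubspaces hB hN hV (mem_isotropicSubspaces_of_le hM
        (sup_le hY.2.2.1 h2) (by rw [finrank_sup_of_mem_pts hY.2 hY₀ hY.1, hT.2]))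
    rw [e] at e1
    rw [← hiso Y hY.2, ← e2, ← e1]
    push_cast
    ring
  have hc : (I.card : ℝ) = 𝔮 * qNum 𝔮 (b - t) := by
    have := ncard_pts hTM
    rw [Set.ncard_eq_toFinset_card, hM.2, hT.2, show b + 1 - t = b - t + 1 by omega,
      qNum_succ] at this
    rw [Finset.card_erase_of_mem (by simpa using hY₀), Nat.cast_sub]
    · rw [this]; simp
    · exact Finset.card_pos.2 ⟨Y₀, by simpa using hY₀⟩
  have hle : (C₁ B M T m t).ncard ≤ (star P Y₀).ncard + ∑ Y ∈ I, (star P Y \ star P Y₀).ncard :=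
    (Set.ncard_le_ncard hsub (Set.toFinite _)).trans ((Set.ncard_union_le _ _).trans
      (Nat.add_le_add_left (Finset.set_ncard_biUnion_le _ _) _))
  have hle' : ((C₁ B M T m t).ncard : ℝ)
      ≤ (star P Y₀).ncard + ∑ Y ∈ I, ((star P Y \ star P Y₀).ncard : ℝ) := by exact_mod_cast hle
  rw [hiso Y₀ hY₀, Finset.sum_congr rfl hI, Finset.sum_const, nsmul_eq_mul, hc] at hle'
  rw [qNum_succ]
  linarith

/-- Second-moment lower bound. Let x be the number of extensions of T in M lying in F. Sum (q+2)x -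
x² over all isotropic F, using that each term is at most q+1 on C₁ and 0 elsewhere. -/
theorem le_ncard_C₁ (hB : B.IsAlt) (hN : B.Nondegenerate) (hV : finrank K V = 2 * ν) {m b : ℕ}
    {M T : Submodule K V} (hM : M ∈ isotropicSubspaces B (b + 1))
    (hT : T ∈ isotropicSubspaces B t) (hTM : T ≤ M) (htb : t ≤ b) :
    qNum 𝔮 (b - t + 1) * ((𝔮 + 1) * isoNum 𝔮 ν (t + 1) m
      - 𝔮 * qNum 𝔮 (b - t) * isoNum 𝔮 ν (t + 2) m) ≤ (𝔮 + 1) * (C₁ B M T m t).ncard := by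
  classical
  have hq : (2 : ℝ) ≤ 𝔮 := two_le_card
  set P := isotropicSubspaces B m
  have hiso : ∀ Y ∈ pts T M, ((star P Y).ncard : ℝ) = isoNum 𝔮 ν (t + 1) m := fun Y hY =>
    ncard_star_isotropicSubspaces hB hN hV
      (mem_isotropicSubspaces_of_le hM hY.2.1 (by rw [hY.2.2, hT.2]))
  have hx : (pts T M).ncard = qNum 𝔮 (b - t + 1) := by
    rw [ncard_pts hTM, hM.2, hT.2, show b + 1 - t = b - t + 1 by omega]
  have h1 := sum_ncard_filter_le (pts T M) P
  have h2 := sum_ncard_filter_le_sq (pts T M) P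
  rw [Finset.sum_congr rfl fun Y hY => hiso Y (by simpa using hY), sum_pts_const hTM, hM.2, hT.2,
    show b + 1 - t = b - t + 1 by omega] at h1
  have h3 : ∀ Y ∈ (Set.toFinite (pts T M)).toFinset,
      ∑ Y' ∈ (Set.toFinite (pts T M)).toFinset, ((star P (Y ⊔ Y')).ncard : ℝ)
        = isoNum 𝔮 ν (t + 1) m + 𝔮 * qNum 𝔮 (b - t) * isoNum 𝔮 ν (t + 2) m := by
    intro Y hY
    rw [← Finset.add_sum_erase _ _ hY]
    have hY' := hY
    rw [Set.Finite.mem_toFinset] at hY'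
    rw [sup_idem, hiso Y hY']
    congr 1
    have : ∀ Y' ∈ (Set.toFinite (pts T M)).toFinset.erase Y,
        ((star P (Y ⊔ Y')).ncard : ℝ) = isoNum 𝔮 ν (t + 2) m := by
      intro Z hZ
      rw [Finset.mem_erase, Set.Finite.mem_toFinset] at hZ
      exact ncard_star_isotropicSubspaces hB hN hV (mem_isotropicSubspaces_of_le hM
        (sup_le hY'.2.1 hZ.2.2.1) (by rw [finrank_sup_of_mem_pts hY' hZ.2 hZ.1.symm, hT.2]))
    rw [Finset.sum_congr rfl this, Finset.sum_const, nsmul_eq_mul, Finset.card_erase_of_mem hY,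
      Nat.cast_sub (Finset.card_pos.2 ⟨Y, hY⟩), ← Set.ncard_eq_toFinset_card, hx, qNum_succ]
    simp
  rw [Finset.sum_congr rfl h3, sum_pts_const hTM, hM.2, hT.2,
    show b + 1 - t = b - t + 1 by omega] at h2
  have h4 : ((C₁ B M T m t).ncard : ℝ)
      = ∑ F ∈ (Set.toFinite P).toFinset, if F ∈ C₁ B M T m t then (1 : ℝ) else 0 :=
    ncard_eq_sum_ite fun F hF => hF.1
  -- On C₁ this reads (x-1)(x-(q+1)) ≥ 0, which holds because x = [j+1] is either 1 or at least q+1.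
  have h5 : ∀ F ∈ (Set.toFinite P).toFinset,
      (𝔮 + 2) * (({Y ∈ pts T M | Y ≤ F}).ncard : ℝ) - (({Y ∈ pts T M | Y ≤ F}).ncard : ℝ) ^ 2
        ≤ (𝔮 + 1) * if F ∈ C₁ B M T m t then (1 : ℝ) else 0 := by
    intro F hF
    rw [Set.Finite.mem_toFinset] at hF
    by_cases hFC : F ∈ C₁ B M T m t
    · rw [if_pos hFC]
      have e : {Y ∈ pts T M | Y ≤ F} = pts T (F ⊓ M) := by
        ext Y
        simp only [pts, Set.mem_ofPred_eq, le_inf_iff]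
        tauto
      rw [e, ncard_pts (le_inf hFC.2.1 hTM), hT.2]
      obtain ⟨j, hj⟩ := Nat.exists_eq_add_of_le hFC.2.2
      rw [hj, show t + 1 + j - t = j + 1 by omega, qNum_succ]
      rcases Nat.eq_zero_or_pos j with rfl | hj0
      · rw [qNum_zero]; nlinarith
      · have := one_le_qNum hq hj0
        nlinarith [mul_nonneg (by linarith : (0:ℝ) ≤ 𝔮) (by linarith : 0 ≤ qNum 𝔮 j - 1),
          mul_nonneg (mul_nonneg (by linarith : (0:ℝ) ≤ 𝔮) (by linarith : 0 ≤ 𝔮))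
            (mul_nonneg (by linarith : 0 ≤ qNum 𝔮 j) (by linarith : 0 ≤ qNum 𝔮 j - 1))]
    · rw [if_neg hFC]
      have e : {Y ∈ pts T M | Y ≤ F} = ∅ := by
        rw [Set.eq_empty_iff_forall_notMem]
        exact fun Y hY => hFC (star_C₁_of_mem_pts hT.2 hY.1 ⟨hF, hY.2⟩)
      simp [e]
  have h6 := Finset.sum_le_sum h5
  rw [Finset.sum_sub_distrib, ← Finset.mul_sum, ← Finset.mul_sum, ← h4, h1, h2] at h6
  linarith

/-- Split off the hyperplanes of M that miss T: there are [b+1] hyperplanes, of which [b+1-t]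
contain T. -/
theorem ncard_C₂ (hB : B.IsAlt) (hN : B.Nondegenerate) (hV : finrank K V = 2 * ν) {b : ℕ}
    {M T : Submodule K V} (hM : M ∈ isotropicSubspaces B (b + 1))
    (hT : T ∈ isotropicSubspaces B t) (hTM : T ≤ M) (htb : t ≤ b) :
    ((C₂ B M T b).ncard : ℝ)
      = isoNum 𝔮 ν t b + (qNum 𝔮 (b + 1) - qNum 𝔮 (b + 1 - t)) := by
  have h1 : C₂ B M T b = star (isotropicSubspaces B b) T ∪
      (subspacesIn M b \ star (subspacesIn M b) T) := by
    ext F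
    simp only [C₂, star, subspacesIn, Set.mem_union, Set.mem_ofPred_eq, Set.mem_sdiff]
    have : F ≤ M → finrank K F = b → F ∈ isotropicSubspaces B b := fun h1 h2 =>
      mem_isotropicSubspaces_of_le hM h1 h2
    tauto
  rw [h1, Set.ncard_union_eq _ (Set.toFinite _) (Set.toFinite _)]
  · have h2 := ncard_star_isotropicSubspaces hB hN hV (m := b) hT
    have h3 := ncard_subspacesIn hM.2
    have h4 := ncard_star_subspacesIn hTM (by rw [hT.2]; exact htb) hM.2
    have h5 : star (subspacesIn M b) T ⊆ subspacesIn M b := fun F hF => hF.1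
    have h6 := Set.ncard_sdiff_add_ncard_of_subset h5 (Set.toFinite _)
    have h7 := congrArg (Nat.cast : ℕ → ℝ) h6
    push_cast at h7 ⊢
    rw [hT.2] at h4
    linarith
  · rw [Set.disjoint_left]
    rintro F hF ⟨h2, h3⟩
    exact h3 ⟨h2, hF.2⟩

end ExplicitFamilies

/-! ### The extremal pairs are non-trivial cross-intersecting -/

section Nontrivial

variable {K V : Type*} [Field K] [AddCommGroup V] [Module K V]
  {B : LinearMap.BilinForm K V} {ν t : ℕ}

theorem CrossIntersecting.symm {F G : Set (Submodule K V)} (h : CrossIntersecting t F G) :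
    CrossIntersecting t G F :=
  fun A hA C hC => by rw [inf_comm]; exact h C hC A hA

theorem IsNontrivialCross.symm {a b : ℕ} {F G : Set (Submodule K V)}
    (h : IsNontrivialCross B a b t F G) : IsNontrivialCross B b a t G F where
  subset_left := h.subset_right
  subset_right := h.subset_left
  cross := h.cross.symm
  nontrivial := fun ⟨T, hT, h1, h2⟩ => h.nontrivial ⟨T, hT, h2, h1⟩

variable [Finite V] [Finite K]

local notation "𝔮" => ((Nat.card K : ℕ) : ℝ)

/-- Otherwise everything through W would pass through a fixed (t+1)-space between W and W ⊔ T,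
contradicting N_m(t+1) < N_m(t). -/
theorem le_of_forall_star_le (hB : B.IsAlt) (hN : B.Nondegenerate) (hV : finrank K V = 2 * ν)
    {m : ℕ} (htm : t < m) (hm : m ≤ ν) {W T : Submodule K V} (hW : W ∈ isotropicSubspaces B t)
    (h : ∀ F ∈ isotropicSubspaces B m, W ≤ F → T ≤ F) : T ≤ W := by
  have hq : (2 : ℝ) ≤ 𝔮 := two_le_card
  by_contra hTW
  have hlt : finrank K W < finrank K ↥(W ⊔ T) := by
    refine Submodule.finrank_lt_finrank_of_lt (lt_of_le_of_ne le_sup_left fun h => hTW ?_)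
    rw [h]; exact le_sup_right
  obtain ⟨Y, h1, h2, h3⟩ := exists_between_finrank_eq (le_sup_left : W ≤ W ⊔ T) (n := t + 1)
    (by rw [hW.2]; omega) (by rw [hW.2] at hlt; omega)
  have hsub : star (isotropicSubspaces B m) W ⊆ star (isotropicSubspaces B m) Y :=
    fun F hF => ⟨hF.1, h2.trans (sup_le hF.2 (h F hF.1 hF.2))⟩
  have h4 : ((star (isotropicSubspaces B m) W).ncard : ℝ)
      ≤ (star (isotropicSubspaces B m) Y).ncard := by
    exact_mod_cast Set.ncard_le_ncard hsub (Set.toFinite _)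
  rw [ncard_star_isotropicSubspaces hB hN hV hW] at h4
  have h5 := h4.trans (ncard_star_le_isoNum hB hN hV subset_rfl h3)
  have h6 := isoNum_mul_qNum hq ν t m
  have h7 := isoNum_pos hq (show t + 1 ≤ m by omega) hm
  have h8 := qNum_pos hq (show 1 ≤ m - t by omega)
  have h9 := two_pow_mul_qNum_le hq 1 (m - t)
  have h10 := qNum_mono hq (show 1 + (m - t) ≤ 2 * (ν - t) by omega)
  nlinarith

theorem isNontrivialCross_C₃_C₄ (hB : B.IsAlt) (hN : B.Nondegenerate)
    (hV : finrank K V = 2 * ν) {a b : ℕ} (ht : 1 ≤ t) (htb : t < b) (hb : b ≤ ν)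
    {S : Submodule K V} (hS : S ∈ isotropicSubspaces B (t + 1)) :
    IsNontrivialCross B a b t (C₃ B S a) (C₄ B S b t) where
  subset_left := fun F hF => hF.1
  subset_right := fun F hF => hF.1
  cross := fun A hA C hC =>
    hC.2.trans (Submodule.finrank_mono (le_inf (inf_le_right.trans hA.2) inf_le_left))
  nontrivial := by
    rintro ⟨T, hT, -, h⟩
    have hq : (2 : ℝ) ≤ 𝔮 := two_le_card
    have h1 : 1 < (subspacesIn S t).ncard := by
      have := ncard_subspacesIn hS.2
      have h2 := one_le_qNum hq ht
      rw [qNum_succ] at this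
      have h3 : (1 : ℝ) < (subspacesIn S t).ncard := by nlinarith
      exact_mod_cast h3
    -- C₄ contains every m-space through any t-subspace W of S, so a common T would lie in a W
    -- different from T.
    obtain ⟨W, hW, hne⟩ := Set.exists_ne_of_one_lt_ncard h1 T
    have hW' := mem_isotropicSubspaces_of_le hS hW.1 hW.2
    have hTW : T ≤ W := le_of_forall_star_le hB hN hV htb hb hW' fun F hF hWF =>
      h F ⟨hF, by rw [← hW.2]; exact Submodule.finrank_mono (le_inf hWF hW.1)⟩
    exact hne (Submodule.eq_of_le_of_finrank_eq hTW (by rw [hT.2, hW.2])).symm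

theorem isNontrivialCross_C₁_C₂ (hB : B.IsAlt) (hN : B.Nondegenerate)
    (hV : finrank K V = 2 * ν) {a b : ℕ} (ht : 1 ≤ t) (htb : t < b) (hb : b ≤ ν)
    {M T : Submodule K V} (hM : M ∈ isotropicSubspaces B (b + 1))
    (hT : T ∈ isotropicSubspaces B t) (hTM : T ≤ M) :
    IsNontrivialCross B a b t (C₁ B M T a t) (C₂ B M T b) where
  subset_left := fun F hF => hF.1
  subset_right := by
    rintro F (hF | hF)
    · exact hF.1
    · exact mem_isotropicSubspaces_of_le hM hF.1 hF.2
  cross := by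
    rintro A hA C (hC | hC)
    · rw [← hT.2]
      exact Submodule.finrank_mono (le_inf hA.2.1 hC.2)
    · have h1 := Submodule.finrank_sup_add_finrank_inf_eq (A ⊓ M) C
      have h2 := Submodule.finrank_mono (sup_le (inf_le_right : A ⊓ M ≤ M) hC.1)
      have h3 := Submodule.finrank_mono
        (inf_le_inf_right C (inf_le_left : A ⊓ M ≤ A))
      have h4 := hA.2.2
      rw [hM.2] at h2
      rw [hC.2] at h1
      omega
  nontrivial := by
    rintro ⟨T', hT', -, h⟩
    have hq : (2 : ℝ) ≤ 𝔮 := two_le_card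
    have hTT : T' ≤ T := le_of_forall_star_le hB hN hV htb hb hT fun F hF hTF =>
      h F (Or.inl ⟨hF, hTF⟩)
    obtain rfl : T' = T := Submodule.eq_of_le_of_finrank_eq hTT (by rw [hT.2, hT'.2])
    -- The common space can only be T, yet not every hyperplane of M contains T.
    have h1 : subspacesIn M b ⊆ star (subspacesIn M b) T' := fun F hF =>
      ⟨hF, h F (Or.inr hF)⟩
    have h2 : ((subspacesIn M b).ncard : ℝ) ≤ (star (subspacesIn M b) T').ncard := by
      exact_mod_cast Set.ncard_le_ncard h1 (Set.toFinite _)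
    rw [ncard_subspacesIn hM.2, ncard_star_subspacesIn hTM (by rw [hT.2]; omega) hM.2, hT.2] at h2
    have h3 := two_pow_mul_qNum_le hq 1 (b + 1 - t)
    have h4 := qNum_mono hq (show 1 + (b + 1 - t) ≤ b + 1 by omega)
    have h5 := qNum_pos hq (show 1 ≤ b + 1 - t by omega)
    linarith

theorem exists_isotropicSubspaces (hB : B.IsAlt) (hN : B.Nondegenerate)
    (hV : finrank K V = 2 * ν) {m : ℕ} (hm : m ≤ ν) : ∃ F, F ∈ isotropicSubspaces B m := by
  have h0 : (⊥ : Submodule K V) ∈ isotropicSubspaces B 0 :=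
    ⟨fun x hx y _ => by rw [(Submodule.mem_bot K).1 hx]; simp, finrank_bot K V⟩
  have h := ncard_star_isotropicSubspaces hB hN hV (m := m) h0
  have h1 : (star (isotropicSubspaces B m) ⊥).ncard ≠ 0 := by
    have := isoNum_pos (two_le_card (K := K)) (Nat.zero_le m) hm
    rw [← h] at this
    exact_mod_cast this.ne'
  obtain ⟨F, hF⟩ := Set.nonempty_of_ncard_ne_zero h1
  exact ⟨F, hF.1⟩

theorem exists_isotropicSubspaces_pair (hB : B.IsAlt) (hN : B.Nondegenerate)
    (hV : finrank K V = 2 * ν) {m k : ℕ} (hkm : k ≤ m) (hm : m ≤ ν) :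
    ∃ M ∈ isotropicSubspaces B m, ∃ T ∈ isotropicSubspaces B k, T ≤ M := by
  obtain ⟨M, hM⟩ := exists_isotropicSubspaces hB hN hV hm
  obtain ⟨T, hT, hTk⟩ := exists_le_finrank_eq (Z := M) (n := k) (by rw [hM.2]; exact hkm)
  exact ⟨M, hM, T, mem_isotropicSubspaces_of_le hM hT hTk, hT⟩

end Nontrivial

/-! ### Covers and the branching bounds -/

section Covers

variable {K V : Type*} [Field K] [AddCommGroup V] [Module K V]

/-- A totally isotropic subspace that meets every member of a family in dimension at least `t`. -/
def IsCover (B : LinearMap.BilinForm K V) (t : ℕ) (𝓐 : Set (Submodule K V))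
    (X : Submodule K V) : Prop :=
  IsTotallyIsotropic B X ∧ ∀ A ∈ 𝓐, t ≤ finrank K ↥(X ⊓ A)

variable {B : LinearMap.BilinForm K V} {ν t a b : ℕ} {𝓐 𝓑 : Set (Submodule K V)}

theorem star_eq_empty (h𝓑 : 𝓑 ⊆ isotropicSubspaces B b) {X : Submodule K V}
    (hX : ¬ IsTotallyIsotropic B X) : star 𝓑 X = ∅ := by
  rw [Set.eq_empty_iff_forall_notMem]
  exact fun F hF => hX ((h𝓑 hF.1).1.mono hF.2)

theorem CrossIntersecting.isCover (h : CrossIntersecting t 𝓐 𝓑)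
    (h𝓑 : 𝓑 ⊆ isotropicSubspaces B b) {C : Submodule K V} (hC : C ∈ 𝓑) : IsCover B t 𝓐 C :=
  ⟨(h𝓑 hC).1, fun A hA => by rw [inf_comm]; exact h A hA C hC⟩

theorem IsCover.le_finrank [FiniteDimensional K V] (h𝓐 : 𝓐.Nonempty) {X : Submodule K V}
    (hX : IsCover B t 𝓐 X) : t ≤ finrank K X := by
  obtain ⟨A, hA⟩ := h𝓐
  exact (hX.2 A hA).trans (Submodule.finrank_mono inf_le_left)

theorem isCover_of_forall_le [FiniteDimensional K V] {T : Submodule K V}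
    (hT : T ∈ isotropicSubspaces B t) (h : ∀ A ∈ 𝓐, T ≤ A) : IsCover B t 𝓐 T :=
  ⟨hT.1, fun A hA => by rw [inf_eq_left.2 (h A hA), hT.2]⟩

theorem IsCover.forall_le [FiniteDimensional K V] {T : Submodule K V} (hT : finrank K T = t)
    (h : IsCover B t 𝓐 T) : ∀ A ∈ 𝓐, T ≤ A := fun A hA =>
  inf_eq_left.1 (Submodule.eq_of_le_of_finrank_le inf_le_left (by rw [hT]; exact h.2 A hA))

theorem exists_min_isCover (h : CrossIntersecting t 𝓐 𝓑) (h𝓑 : 𝓑 ⊆ isotropicSubspaces B b)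
    (h𝓑n : 𝓑.Nonempty) : ∃ S, IsCover B t 𝓐 S ∧ finrank K S ≤ b ∧
      ∀ X : Submodule K V, finrank K X < finrank K S → ¬ IsCover B t 𝓐 X := by
  obtain ⟨C, hC⟩ := h𝓑n
  obtain ⟨S, hS, hmin⟩ := exists_minimalFor_of_wellFoundedLT (IsCover B t 𝓐)
    (fun S : Submodule K V => finrank K S) ⟨C, h.isCover h𝓑 hC⟩
  refine ⟨S, hS, ?_, fun X hX hcov => ?_⟩
  · rw [← (h𝓑 hC).2]
    by_contra! hlt
    have := hmin (h.isCover h𝓑 hC) hlt.le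
    simp only at this
    omega
  · have := hmin hcov hX.le
    simp only at this
    omega

variable [Finite V]

theorem exists_expansion_of_not_isCover (h : CrossIntersecting t 𝓐 𝓑)
    (h𝓐 : 𝓐 ⊆ isotropicSubspaces B a) (hta : t ≤ a) {X : Submodule K V}
    (hX : IsTotallyIsotropic B X) (hnot : ¬ IsCover B t 𝓐 X) :
    ∃ Z, X ≤ Z ∧ finrank K Z = finrank K X + (a - t + 1) ∧
      ∀ C ∈ star 𝓑 X, ∃ Y ∈ pts X Z, Y ≤ C := by
  simp only [IsCover, hX, true_and, not_forall, not_le] at hnot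
  obtain ⟨A, hA, hlt⟩ := hnot
  have hAa := (h𝓐 hA).2
  obtain ⟨Z, h1, h2, h3⟩ := exists_expansion (by omega) hlt
  rw [hAa] at h2
  exact ⟨Z, h1, h2, fun C hC => h3 C hC.2 (by rw [inf_comm]; exact h A hA C hC.1)⟩

variable [Finite K]

local notation "𝔮" => ((Nat.card K : ℕ) : ℝ)

/-- Branching step: some A in 𝓐 meets X too little, and `exists_expansion` forces each member of 𝓑
through X into one of [a-t+1] extensions of X. -/
theorem ncard_star_le_of_not_isCover (h : CrossIntersecting t 𝓐 𝓑)
    (h𝓐 : 𝓐 ⊆ isotropicSubspaces B a) (h𝓑 : 𝓑 ⊆ isotropicSubspaces B b) (hta : t ≤ a)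
    {X : Submodule K V} (hnot : ¬ IsCover B t 𝓐 X) {c : ℝ} (hc : 0 ≤ c)
    (hY : ∀ Y : Submodule K V, finrank K Y = finrank K X + 1 → ((star 𝓑 Y).ncard : ℝ) ≤ c) :
    ((star 𝓑 X).ncard : ℝ) ≤ qNum 𝔮 (a - t + 1) * c := by
  have hq : (2 : ℝ) ≤ 𝔮 := two_le_card
  by_cases hX : IsTotallyIsotropic B X
  · obtain ⟨Z, h1, h2, h3⟩ := exists_expansion_of_not_isCover h h𝓐 hta hX hnot
    have h4 := ncard_pts h1
    rw [h2, Nat.add_sub_cancel_left] at h4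
    rw [← h4]
    refine ncard_le_of_forall_exists h3 fun Y hYm => le_trans ?_ (hY Y hYm.2.2)
    have hs : star (star 𝓑 X) Y ⊆ star 𝓑 Y := fun F hF => ⟨hF.1.1, hF.2⟩
    exact_mod_cast Set.ncard_le_ncard hs (Set.toFinite _)
  · rw [star_eq_empty h𝓑 hX, Set.ncard_empty, Nat.cast_zero]
    exact mul_nonneg (qNum_nonneg hq _) hc

/-- Below dimension τ nothing is a cover, so the branching step can be repeated τ - k times. -/
theorem ncard_star_le_pow_mul_isoNum (hB : B.IsAlt) (hN : B.Nondegenerate)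
    (hV : finrank K V = 2 * ν) (h : CrossIntersecting t 𝓐 𝓑)
    (h𝓐 : 𝓐 ⊆ isotropicSubspaces B a) (h𝓑 : 𝓑 ⊆ isotropicSubspaces B b) (hta : t ≤ a)
    {τ : ℕ} (hτ : ∀ X : Submodule K V, finrank K X < τ → ¬ IsCover B t 𝓐 X) {X : Submodule K V} {k : ℕ}
    (hX : finrank K X = k) (hk : k ≤ τ) :
    ((star 𝓑 X).ncard : ℝ) ≤ qNum 𝔮 (a - t + 1) ^ (τ - k) * isoNum 𝔮 ν τ b := by
  have hq : (2 : ℝ) ≤ 𝔮 := two_le_card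
  obtain ⟨d, rfl⟩ := Nat.exists_eq_add_of_le hk
  clear hk
  rw [Nat.add_sub_cancel_left]
  induction d generalizing k X with
  | zero => simpa using ncard_star_le_isoNum hB hN hV h𝓑 hX
  | succ d ih =>
    rw [pow_succ', mul_assoc]
    refine ncard_star_le_of_not_isCover h h𝓐 h𝓑 hta (hτ X (by omega))
      (mul_nonneg (pow_nonneg (qNum_nonneg hq _) _) (isoNum_nonneg hq _ _ _)) fun Y hY => ?_
    have e : k + (d + 1) = k + 1 + d := by omega
    rw [e] at hτ ⊢
    exact ih (by rw [hY, hX]) hτ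

/-- Every member of 𝓑 contains a t-subspace of S; apply the union bound over these. -/
theorem ncard_le_of_isCover {S : Submodule K V} (hS : IsCover B t 𝓑 S) (ht : t ≤ finrank K S)
    {c : ℝ} (hc : 0 ≤ c)
    (hW : ∀ W ≤ S, finrank K W = t → ((star 𝓑 W).ncard : ℝ) ≤ c) :
    (𝓑.ncard : ℝ) ≤ qNum 𝔮 (t + 1) ^ (finrank K S - t) * c := by
  refine (ncard_le_of_forall_exists (I := subspacesIn S t) (c := c) (fun F hF => ?_)
    fun W hWS => hW W hWS.1 hWS.2).trans ?_
  · obtain ⟨W, hW1, hW2⟩ := exists_le_finrank_eq (hS.2 F hF)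
    exact ⟨W, ⟨hW1.trans inf_le_left, hW2⟩, hW1.trans inf_le_right⟩
  · exact mul_le_mul_of_nonneg_right (ncard_subspacesIn_le ht) hc

end Covers

/-! ### Trading Gaussian integers for one dimension -/

section Estimates

variable {q : ℝ}

theorem mul_isoNum_succ_le (hq : 2 ≤ q) {ν k m : ℕ} {x : ℝ}
    (h : k < m → x * qNum q (m - k) ≤ qNum q (2 * (ν - k))) :
    x * isoNum q ν (k + 1) m ≤ isoNum q ν k m := by
  rcases lt_or_ge k m with hkm | hkm
  · have h1 := isoNum_mul_qNum hq ν k m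
    have h2 := qNum_pos hq (show 1 ≤ m - k by omega)
    have h3 := isoNum_nonneg hq ν (k + 1) m
    have h4 := mul_le_mul_of_nonneg_right (h hkm) h3
    refine le_of_mul_le_mul_right ?_ h2
    rw [h1]
    linarith
  · rw [isoNum_of_lt q ν (show m < k + 1 by omega), mul_zero]
    exact isoNum_nonneg hq _ _ _

theorem pow_mul_isoNum_le (hq : 2 ≤ q) {ν s m : ℕ} {x : ℝ} (hx : 0 ≤ x)
    (h : ∀ k, s ≤ k → k < m → x * qNum q (m - k) ≤ qNum q (2 * (ν - k))) {τ : ℕ} (hτ : s ≤ τ) :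
    x ^ (τ - s) * isoNum q ν τ m ≤ isoNum q ν s m := by
  obtain ⟨d, rfl⟩ := Nat.exists_eq_add_of_le hτ
  rw [Nat.add_sub_cancel_left]
  clear hτ
  induction d with
  | zero => simp
  | succ d ih =>
    refine le_trans ?_ ih
    rw [pow_succ, mul_assoc]
    exact mul_le_mul_of_nonneg_left
      (mul_isoNum_succ_le hq fun hlt => h (s + d) (by omega) hlt) (pow_nonneg hx _)

/-- With its variants for more factors, this reduces every numerical hypothesis of
`mul_isoNum_succ_le` to a linear inequality between indices. -/
theorem two_pow_mul_qNum_mul_qNum_le (hq : 2 ≤ q) {k x y n : ℕ} (h : k + (x + y) ≤ n) :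
    2 ^ k * (qNum q x * qNum q y) ≤ qNum q n :=
  (mul_le_mul_of_nonneg_left (qNum_mul_le hq x y) (by positivity)).trans
    ((two_pow_mul_qNum_le hq k _).trans (qNum_mono hq h))

theorem two_pow_mul_three_qNum_le (hq : 2 ≤ q) {k x y z n : ℕ} (h : k + (x + y + z) ≤ n) :
    2 ^ k * (qNum q x * qNum q y * qNum q z) ≤ qNum q n :=
  (mul_le_mul_of_nonneg_left
    (mul_le_mul_of_nonneg_right (qNum_mul_le hq x y) (qNum_nonneg hq z)) (by positivity)).trans
    (two_pow_mul_qNum_mul_qNum_le hq h)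

theorem two_pow_mul_four_qNum_le (hq : 2 ≤ q) {k w x y z n : ℕ} (h : k + (w + x + y + z) ≤ n) :
    2 ^ k * (qNum q w * qNum q x * qNum q y * qNum q z) ≤ qNum q n :=
  (mul_le_mul_of_nonneg_left (mul_le_mul_of_nonneg_right
    (mul_le_mul_of_nonneg_right (qNum_mul_le hq w x) (qNum_nonneg hq y))
      (qNum_nonneg hq z)) (by positivity)).trans
    (two_pow_mul_three_qNum_le hq h)

end Estimates

/-! ### A common t-space in one family -/

section Structure

variable {K V : Type*} [Field K] [AddCommGroup V] [Module K V]
  {B : LinearMap.BilinForm K V} {ν t a b : ℕ} {F G : Set (Submodule K V)}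

theorem IsTotallyIsotropic.sup (hB : B.IsAlt) {X Y : Submodule K V} (hX : IsTotallyIsotropic B X)
    (hY : IsTotallyIsotropic B Y) (hXY : Y ≤ B.orthogonal X) : IsTotallyIsotropic B (X ⊔ Y) := by
  have h1 : ∀ x ∈ X, ∀ y ∈ Y, B x y = 0 := fun x hx y hy => hXY hy x hx
  have h2 : ∀ x ∈ X, ∀ y ∈ Y, B y x = 0 := fun x hx y hy => hB.isRefl _ _ (h1 x hx y hy)
  intro x hx y hy
  rw [Submodule.mem_sup] at hx hy
  obtain ⟨x₁, hx₁, x₂, hx₂, rfl⟩ := hx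
  obtain ⟨y₁, hy₁, y₂, hy₂, rfl⟩ := hy
  simp [hX x₁ hx₁ y₁ hy₁, hY x₂ hx₂ y₂ hy₂, h1 x₁ hx₁ y₂ hy₂, h2 y₁ hy₁ x₂ hx₂]

theorem star_eq_self {𝒢 : Set (Submodule K V)} {X : Submodule K V} (h : ∀ A ∈ 𝒢, X ≤ A) :
    star 𝒢 X = 𝒢 :=
  Set.Subset.antisymm (fun _ hA => hA.1) fun A hA => ⟨hA, h A hA⟩

variable [Finite V]

theorem finrank_lt_finrank_sup {X Y : Submodule K V} (h : ¬ X ≤ Y) :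
    finrank K Y < finrank K ↥(X ⊔ Y) :=
  Submodule.finrank_lt_finrank_of_lt (lt_of_le_of_ne le_sup_right fun h' => h (by
    rw [h']; exact le_sup_left))

/-- If every `(t + 1)`-dimensional cover of `G` contains `T` and `C ∈ G` does not, then all these
covers lie in the `(b + 1)`-dimensional space `T ⊔ C`. -/
theorem le_sup_of_isCover (hG : G ⊆ isotropicSubspaces B b) {T C S : Submodule K V}
    (hC : C ∈ G) (hTC : ¬ T ≤ C) (hS : IsCover B t G S) (hSt : finrank K S = t + 1) (hTS : T ≤ S) :
    S ≤ T ⊔ C ∧ finrank K ↥(T ⊔ C) = b + 1 := by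
  have h1 : t ≤ finrank K ↥(S ⊓ C) := hS.2 C hC
  have h2 : ¬ T ≤ S ⊓ C := fun h => hTC (h.trans inf_le_right)
  have h3 := finrank_lt_finrank_sup h2
  -- S ∩ C has dimension at least t and does not contain T, so adding T already fills S.
  have h4 : T ⊔ (S ⊓ C) = S :=
    Submodule.eq_of_le_of_finrank_le (sup_le hTS inf_le_left) (by omega)
  have h5 : S ≤ T ⊔ C := by
    calc S = T ⊔ (S ⊓ C) := h4.symm
      _ ≤ T ⊔ C := sup_le_sup_left inf_le_right _
  -- Written as S ⊔ C, its dimension is at most (t+1) + b - t; written as T ⊔ C, it exceeds b.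
  have h6 : T ⊔ C = S ⊔ C := le_antisymm (sup_le_sup_right hTS _) (sup_le h5 le_sup_right)
  have h7 := Submodule.finrank_sup_add_finrank_inf_eq S C
  have h8 := finrank_lt_finrank_sup hTC
  rw [(hG hC).2] at h7 h8
  rw [← h6] at h7
  exact ⟨h5, by omega⟩

variable [Finite K]

local notation "𝔮" => ((Nat.card K : ℕ) : ℝ)

/-- A t-dimensional cover lies in every member, so suppose the smallest covers S₁ of F and S₂ of G
both have dimension above t. Bounding each family by the t-subspaces of its own cover, and their
stars by branching up to the dimension of the other cover, makes the product at most half of a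
quantity of which it is at least 3/4. -/
theorem exists_common_of_large (hB : B.IsAlt) (hN : B.Nondegenerate) (hV : finrank K V = 2 * ν)
    (ht : 1 ≤ t) (hta : t + 1 ≤ a) (htb : t + 1 ≤ b) (h₁ : 2 * a + b + t + 3 ≤ 2 * ν)
    (h₂ : a + 2 * b + t + 3 ≤ 2 * ν) (h : IsNontrivialCross B a b t F G)
    (hS : 3 * (qNum 𝔮 (t + 1) * (isoNum 𝔮 ν (t + 1) a * isoNum 𝔮 ν t b))
      ≤ 4 * ((F.ncard : ℝ) * G.ncard))
    (hM : 3 * (qNum 𝔮 (b - t + 1) * (isoNum 𝔮 ν (t + 1) a * isoNum 𝔮 ν t b))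
      ≤ 4 * ((F.ncard : ℝ) * G.ncard))
    (hF : F.Nonempty) (hG : G.Nonempty) :
    ∃ T ∈ isotropicSubspaces B t, (∀ A ∈ F, T ≤ A) ∨ (∀ C ∈ G, T ≤ C) := by
  have hq : (2 : ℝ) ≤ 𝔮 := two_le_card
  obtain ⟨S₁, hS₁, hS₁b, hmin₁⟩ := exists_min_isCover h.cross h.subset_right hG
  obtain ⟨S₂, hS₂, hS₂a, hmin₂⟩ := exists_min_isCover h.cross.symm h.subset_left hF
  have ht₁ := hS₁.le_finrank hF
  have ht₂ := hS₂.le_finrank hG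
  rcases ht₁.eq_or_lt with e₁ | e₁
  · exact ⟨S₁, ⟨hS₁.1, e₁.symm⟩, Or.inl (hS₁.forall_le e₁.symm)⟩
  rcases ht₂.eq_or_lt with e₂ | e₂
  · exact ⟨S₂, ⟨hS₂.1, e₂.symm⟩, Or.inr (hS₂.forall_le e₂.symm)⟩
  exfalso
  -- The worst case is a cover of dimension t+1: each further dimension gains [t+1]·[a-t+1] but
  -- loses at least as much in `isoNum`.
  have bound : ∀ {a b : ℕ} {S₁ : Submodule K V}, t + 1 ≤ a → a + 2 * b + t + 3 ≤ 2 * ν →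
      t < finrank K S₁ →
      (qNum 𝔮 (t + 1) * qNum 𝔮 (a - t + 1)) ^ (finrank K S₁ - t) * isoNum 𝔮 ν (finrank K S₁) b
        ≤ qNum 𝔮 (t + 1) * qNum 𝔮 (a - t + 1) * isoNum 𝔮 ν (t + 1) b := by
    intro a b S₁ hta h₂ e₁
    have h3 := mul_nonneg (qNum_nonneg hq (t + 1)) (qNum_nonneg hq (a - t + 1))
    rw [show finrank K S₁ - t = finrank K S₁ - (t + 1) + 1 by omega, pow_succ', mul_assoc]
    refine mul_le_mul_of_nonneg_left (pow_mul_isoNum_le hq h3 (fun k hk hkb => ?_) e₁) h3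
    simpa using two_pow_mul_three_qNum_le hq (k := 0) (x := t + 1) (y := a - t + 1) (z := b - k)
      (n := 2 * (ν - k)) (by omega)
  have hGle := ncard_le_of_isCover hS₂ ht₂ (c := qNum 𝔮 (a - t + 1) ^ (finrank K S₁ - t)
        * isoNum 𝔮 ν (finrank K S₁) b)
      (mul_nonneg (pow_nonneg (qNum_nonneg hq _) _) (isoNum_nonneg hq _ _ _))
      fun W _ hW => ncard_star_le_pow_mul_isoNum hB hN hV h.cross h.subset_left h.subset_right
        (by omega) hmin₁ hW ht₁
  have hFle := ncard_le_of_isCover hS₁ ht₁ (c := qNum 𝔮 (b - t + 1) ^ (finrank K S₂ - t)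
        * isoNum 𝔮 ν (finrank K S₂) a)
      (mul_nonneg (pow_nonneg (qNum_nonneg hq _) _) (isoNum_nonneg hq _ _ _))
      fun W _ hW => ncard_star_le_pow_mul_isoNum hB hN hV h.cross.symm h.subset_right
        h.subset_left (by omega) hmin₂ hW ht₂
  have hb₁ := bound (b := b) hta h₂ e₁
  have hb₂ := bound (b := a) htb (by omega) e₂
  have p₁ := qNum_nonneg hq (t + 1)
  have p₂ := qNum_nonneg hq (a - t + 1)
  have p₃ := qNum_nonneg hq (b - t + 1)
  have p₄ := isoNum_nonneg hq ν (finrank K S₁) b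
  have p₅ := isoNum_nonneg hq ν (finrank K S₂) a
  have n₁ := isoNum_pos hq hta (show a ≤ ν by omega)
  have n₂ := isoNum_pos hq htb (show b ≤ ν by omega)
  have n₃ := isoNum_pos hq (show t ≤ b by omega) (show b ≤ ν by omega)
  have hprod : (F.ncard : ℝ) * G.ncard
      ≤ (qNum 𝔮 (t + 1) * qNum 𝔮 (a - t + 1) * isoNum 𝔮 ν (t + 1) b)
        * (qNum 𝔮 (t + 1) * qNum 𝔮 (b - t + 1) * isoNum 𝔮 ν (t + 1) a) := by
    calc (F.ncard : ℝ) * G.ncard ≤ _ := mul_le_mul hFle hGle (by positivity) (by positivity)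
      _ = ((qNum 𝔮 (t + 1) * qNum 𝔮 (a - t + 1)) ^ (finrank K S₁ - t)
            * isoNum 𝔮 ν (finrank K S₁) b)
          * ((qNum 𝔮 (t + 1) * qNum 𝔮 (b - t + 1)) ^ (finrank K S₂ - t)
            * isoNum 𝔮 ν (finrank K S₂) a) := by rw [mul_pow, mul_pow]; ring
      _ ≤ _ := mul_le_mul hb₁ hb₂ (by positivity) (by positivity)
  -- Contradict the lower bound with the larger of [b-t+1] and [t+1]; the remaining factors are
  -- absorbed, with a spare 1/2, in passing from N_b(t+1) to N_b(t).
  rcases le_total (2 * t) b with hbt | hbt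
  · have h3 := mul_isoNum_succ_le hq (ν := ν) (k := t) (m := b)
      (x := 2 ^ 1 * (qNum 𝔮 (t + 1) * qNum 𝔮 (t + 1) * qNum 𝔮 (a - t + 1))) fun _ => by
        have := two_pow_mul_four_qNum_le hq (k := 1) (w := t + 1) (x := t + 1) (y := a - t + 1)
          (z := b - t) (n := 2 * (ν - t)) (by omega)
        linarith
    have h4 := mul_le_mul_of_nonneg_left h3 (mul_nonneg p₃ n₁.le)
    have h5 : 0 < qNum 𝔮 (b - t + 1) * (isoNum 𝔮 ν (t + 1) a * isoNum 𝔮 ν t b) :=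
      mul_pos (qNum_pos hq (by omega)) (mul_pos n₁ n₃)
    nlinarith
  · have h3 := mul_isoNum_succ_le hq (ν := ν) (k := t) (m := b)
      (x := 2 ^ 1 * (qNum 𝔮 (t + 1) * qNum 𝔮 (b - t + 1) * qNum 𝔮 (a - t + 1))) fun _ => by
        have := two_pow_mul_four_qNum_le hq (k := 1) (w := t + 1) (x := b - t + 1) (y := a - t + 1)
          (z := b - t) (n := 2 * (ν - t)) (by omega)
        linarith
    have h4 := mul_le_mul_of_nonneg_left h3 (mul_nonneg p₁ n₁.le)
    have h5 : 0 < qNum 𝔮 (t + 1) * (isoNum 𝔮 ν (t + 1) a * isoNum 𝔮 ν t b) :=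
      mul_pos (qNum_pos hq (by omega)) (mul_pos n₁ n₃)
    nlinarith

end Structure

/-! ### The structure of large pairs with a common t-space -/

section Structure

variable {K V : Type*} [Field K] [AddCommGroup V] [Module K V] [Finite V]
  {B : LinearMap.BilinForm K V} {ν t a b : ℕ} {F G : Set (Submodule K V)}

/-- M = T ⊔ C₀ is isotropic because T and C₀ are and M is orthogonal to T. For A in F, A ∩ C₀ has
dimension at least t without containing T, so adding T gives dimension at least t+1 inside A ∩ M. -/
theorem subset_C₁_and_subset_C₂ (hB : B.IsAlt) (hF : F ⊆ isotropicSubspaces B a)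
    (hG : G ⊆ isotropicSubspaces B b) (h : CrossIntersecting t F G) {M T C₀ : Submodule K V}
    (hT : T ∈ isotropicSubspaces B t) (hTF : ∀ A ∈ F, T ≤ A) (hC₀ : C₀ ∈ G) (hTC₀ : ¬ T ≤ C₀)
    (hM : ∀ C ∈ G, ¬ T ≤ C → T ⊔ C = M) (hMd : finrank K M = b + 1) (hMT : M ≤ B.orthogonal T) :
    M ∈ isotropicSubspaces B (b + 1) ∧ T ≤ M ∧ F ⊆ C₁ B M T a t ∧ G ⊆ C₂ B M T b := by
  have hM₀ := hM C₀ hC₀ hTC₀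
  refine ⟨⟨?_, hMd⟩, hM₀ ▸ le_sup_left, fun A hA => ⟨hF hA, hTF A hA, ?_⟩, fun C hC => ?_⟩
  · rw [← hM₀]
    exact hT.1.sup hB (hG hC₀).1 ((hM₀ ▸ le_sup_right : C₀ ≤ M).trans hMT)
  · have h1 := h A hA C₀ hC₀
    have h2 := finrank_lt_finrank_sup (fun h => hTC₀ (h.trans inf_le_right) : ¬ T ≤ A ⊓ C₀)
    have h3 : T ⊔ (A ⊓ C₀) ≤ A ⊓ M := sup_le (le_inf (hTF A hA) (hM₀ ▸ le_sup_left))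
      (inf_le_inf_left _ (hM₀ ▸ le_sup_right))
    have h4 := Submodule.finrank_mono h3
    omega
  · by_cases hTC : T ≤ C
    · exact Or.inl ⟨hG hC, hTC⟩
    · exact Or.inr ⟨hM C hC hTC ▸ le_sup_right, (hG hC).2⟩

variable [Finite K]

local notation "𝔮" => ((Nat.card K : ℕ) : ℝ)

/-- Branch once from T. The branches that are covers lie in M, so there are at most [b-t] ≤
[b-t+1]/2 of them; each other branch splits again and contributes at most 1/8 of a full star.
Altogether 1/2 + 1/8 = 5/8. -/
theorem ncard_le_of_covers_le (hB : B.IsAlt) (hN : B.Nondegenerate) (hV : finrank K V = 2 * ν)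
    (htb : t + 1 ≤ b) (h₁ : 2 * a + b + t + 3 ≤ 2 * ν)
    (h : CrossIntersecting t F G) (hF : F ⊆ isotropicSubspaces B a)
    (hG : G ⊆ isotropicSubspaces B b) {M T : Submodule K V} (hT : T ∈ isotropicSubspaces B t)
    (hTF : ∀ A ∈ F, T ≤ A) (hTG : ¬ IsCover B t G T) (hTM : T ≤ M) (hMd : finrank K M ≤ b)
    (hcov : ∀ S, IsCover B t G S → finrank K S = t + 1 → S ≤ M) :
    8 * (F.ncard : ℝ) ≤ 5 * (qNum 𝔮 (b - t + 1) * isoNum 𝔮 ν (t + 1) a) := by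
  have hq : (2 : ℝ) ≤ 𝔮 := two_le_card
  obtain ⟨Z, hTZ, hZd, hZ⟩ := exists_expansion_of_not_isCover h.symm hG (by omega) hT.1 hTG
  have hZ' : ∀ A ∈ F, ∃ Y ∈ pts T Z, Y ≤ A := fun A hA => hZ A ⟨hA, hTF A hA⟩
  set I : Set (Submodule K V) := {Y ∈ pts T Z | IsCover B t G Y}
  set J : Set (Submodule K V) := {Y ∈ pts T Z | ¬ IsCover B t G Y}
  set F₁ : Set (Submodule K V) := {A ∈ F | ∃ Y ∈ I, Y ≤ A}
  set F₂ : Set (Submodule K V) := {A ∈ F | ∃ Y ∈ J, Y ≤ A}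
  have hFF : F ⊆ F₁ ∪ F₂ := by
    intro A hA
    obtain ⟨Y, hY, hYA⟩ := hZ' A hA
    by_cases hc : IsCover B t G Y
    · exact Or.inl ⟨hA, Y, ⟨hY, hc⟩, hYA⟩
    · exact Or.inr ⟨hA, Y, ⟨hY, hc⟩, hYA⟩
  have hcard : (F.ncard : ℝ) ≤ F₁.ncard + F₂.ncard := by
    exact_mod_cast (Set.ncard_le_ncard hFF (Set.toFinite _)).trans (Set.ncard_union_le _ _)
  have p₁ := isoNum_nonneg hq ν (t + 1) a
  have p₂ := isoNum_nonneg hq ν (t + 2) a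
  have p₃ := qNum_nonneg hq (b - t + 1)
  have hI : (I.ncard : ℝ) ≤ qNum 𝔮 (b - t) := by
    have hs : I ⊆ pts T M := fun Y hY =>
      ⟨hY.1.1, hcov Y hY.2 (by rw [hY.1.2.2, hT.2]), hY.1.2.2⟩
    have : (I.ncard : ℝ) ≤ (pts T M).ncard := by
      exact_mod_cast Set.ncard_le_ncard hs (Set.toFinite _)
    rw [ncard_pts hTM, hT.2] at this
    exact this.trans (qNum_mono hq (by omega))
  have hJ : (J.ncard : ℝ) ≤ qNum 𝔮 (b - t + 1) := by
    have hs : J ⊆ pts T Z := fun Y hY => hY.1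
    have : (J.ncard : ℝ) ≤ (pts T Z).ncard := by
      exact_mod_cast Set.ncard_le_ncard hs (Set.toFinite _)
    rwa [ncard_pts hTZ, hZd, Nat.add_sub_cancel_left] at this
  have hF₁ : (F₁.ncard : ℝ) ≤ I.ncard * isoNum 𝔮 ν (t + 1) a :=
    ncard_le_of_forall_exists (fun A hA => hA.2) fun Y hY =>
      ncard_star_le_isoNum hB hN hV (fun A hA => hF hA.1) (by rw [hY.1.2.2, hT.2])
  have hF₂ : (F₂.ncard : ℝ) ≤ J.ncard * (qNum 𝔮 (b - t + 1) * isoNum 𝔮 ν (t + 2) a) := by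
    refine ncard_le_of_forall_exists (fun A hA => hA.2) fun Y hY => ?_
    have hs : star F₂ Y ⊆ star F Y := fun A hA => ⟨hA.1.1, hA.2⟩
    refine le_trans (by exact_mod_cast Set.ncard_le_ncard hs (Set.toFinite _))
      (ncard_star_le_of_not_isCover h.symm hG hF (by omega) hY.2 p₂ fun X hX => ?_)
    exact ncard_star_le_isoNum hB hN hV hF (by rw [hX, hY.1.2.2, hT.2])
  have h3 := mul_isoNum_succ_le hq (ν := ν) (k := t + 1) (m := a)
    (x := 2 ^ 3 * qNum 𝔮 (b - t + 1)) fun _ => by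
      have := two_pow_mul_qNum_mul_qNum_le hq (k := 3) (x := b - t + 1) (y := a - (t + 1))
        (n := 2 * (ν - (t + 1))) (by omega)
      linarith
  have h4 := two_pow_mul_qNum_le hq 1 (b - t)
  rw [show 1 + (b - t) = b - t + 1 by omega] at h4
  have h5 := mul_le_mul_of_nonneg_right hI p₁
  have h6 := mul_le_mul_of_nonneg_right hJ (mul_nonneg p₃ p₂)
  have h7 := mul_le_mul_of_nonneg_right h4 p₁
  have h8 := mul_le_mul_of_nonneg_left h3 p₃
  nlinarith

/-- T is no cover of G by non-triviality. The case analysis runs over the smallest covers of G;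
every configuration other than the two listed makes the product fall below 3/4 of a benchmark. -/
theorem structure_of_common (hB : B.IsAlt) (hN : B.Nondegenerate) (hV : finrank K V = 2 * ν)
    (ht : 1 ≤ t) (hta : t + 1 ≤ a) (htb : t + 1 ≤ b) (h₁ : 2 * a + b + t + 3 ≤ 2 * ν)
    (h₂ : a + 2 * b + t + 3 ≤ 2 * ν) (h : IsNontrivialCross B a b t F G)
    (hS : 3 * (qNum 𝔮 (t + 1) * (isoNum 𝔮 ν (t + 1) a * isoNum 𝔮 ν t b))
      ≤ 4 * ((F.ncard : ℝ) * G.ncard))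
    (hM : 3 * (qNum 𝔮 (b - t + 1) * (isoNum 𝔮 ν (t + 1) a * isoNum 𝔮 ν t b))
      ≤ 4 * ((F.ncard : ℝ) * G.ncard))
    (hF : F.Nonempty) (hG : G.Nonempty) {T : Submodule K V} (hT : T ∈ isotropicSubspaces B t)
    (hTF : ∀ A ∈ F, T ≤ A) :
    (∃ M ∈ isotropicSubspaces B (b + 1), ∃ T ∈ isotropicSubspaces B t, T ≤ M ∧
      F ⊆ C₁ B M T a t ∧ G ⊆ C₂ B M T b) ∨
    (∃ S ∈ isotropicSubspaces B (t + 1), F ⊆ C₃ B S a ∧ G ⊆ C₄ B S b t) := by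
  have hq : (2 : ℝ) ≤ 𝔮 := two_le_card
  have p₁ := qNum_pos hq (show 1 ≤ t + 1 by omega)
  have p₂ := qNum_pos hq (show 1 ≤ a - t + 1 by omega)
  have p₃ := qNum_pos hq (show 1 ≤ b - t + 1 by omega)
  have n₁ := isoNum_pos hq hta (show a ≤ ν by omega)
  have n₂ := isoNum_pos hq htb (show b ≤ ν by omega)
  have n₃ := isoNum_pos hq (show t ≤ b by omega) (show b ≤ ν by omega)
  have n₄ := isoNum_nonneg hq ν (t + 2) a
  have hUS : 0 < qNum 𝔮 (t + 1) * (isoNum 𝔮 ν (t + 1) a * isoNum 𝔮 ν t b) := by positivity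
  have hUM : 0 < qNum 𝔮 (b - t + 1) * (isoNum 𝔮 ν (t + 1) a * isoNum 𝔮 ν t b) := by positivity
  have hTG : ¬ IsCover B t G T := fun hc => h.nontrivial ⟨T, hT, hTF, hc.forall_le hT.2⟩
  have hFle : (F.ncard : ℝ) ≤ qNum 𝔮 (b - t + 1) * isoNum 𝔮 ν (t + 1) a := by
    rw [← star_eq_self hTF]
    exact ncard_star_le_of_not_isCover h.cross.symm h.subset_right h.subset_left (by omega) hTG
      n₁.le fun Y hY => ncard_star_le_isoNum hB hN hV h.subset_left (by rw [hY, hT.2])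
  have hstar : ∀ W : Submodule K V, finrank K W = t → ¬ IsCover B t F W →
      ((star G W).ncard : ℝ) ≤ qNum 𝔮 (a - t + 1) * isoNum 𝔮 ν (t + 1) b := fun W hW hc =>
    ncard_star_le_of_not_isCover h.cross h.subset_left h.subset_right (by omega) hc
      n₂.le fun Y hY => ncard_star_le_isoNum hB hN hV h.subset_right (by rw [hY, hW])
  -- If G is bounded in terms of N_b(t+1) instead of N_b(t), the product is at most half of
  -- [b-t+1]·U.
  have small : ∀ {x : ℝ}, 0 ≤ x → (G.ncard : ℝ) ≤ x * isoNum 𝔮 ν (t + 1) b →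
      2 * (x * qNum 𝔮 (b - t)) ≤ qNum 𝔮 (2 * (ν - t)) → False := by
    intro x hx h3 h4
    have h5 := mul_isoNum_succ_le hq (ν := ν) (k := t) (m := b) (x := 2 * x) fun _ => by linarith
    have h6 := mul_le_mul hFle h3 (by positivity) (by positivity)
    have h7 := mul_le_mul_of_nonneg_left h5 (mul_nonneg p₃.le n₁.le)
    nlinarith
  obtain ⟨S, hSc, hSa, hmin⟩ := exists_min_isCover h.cross.symm h.subset_left hF
  have htS := hSc.le_finrank hG
  rcases htS.eq_or_lt with e | e
  -- A t-dimensional cover S of G lies in all of G but cannot cover F, so one branching step bounds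
  -- G by N_b(t+1).
  · have hSG := hSc.forall_le e.symm
    have hSF : ¬ IsCover B t F S := fun hc =>
      h.nontrivial ⟨S, ⟨hSc.1, e.symm⟩, hc.forall_le e.symm, hSG⟩
    have h3 := hstar S e.symm hSF
    rw [star_eq_self hSG] at h3
    refine (small p₂.le h3 ?_).elim
    simpa using two_pow_mul_qNum_mul_qNum_le hq (k := 1) (x := a - t + 1) (y := b - t)
      (n := 2 * (ν - t)) (by omega)
  have hGle : (G.ncard : ℝ) ≤ qNum 𝔮 (t + 1) ^ (finrank K S - t) * isoNum 𝔮 ν t b :=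
    ncard_le_of_isCover hSc htS n₃.le fun W _ hW => ncard_star_le_isoNum hB hN hV h.subset_right hW
  rcases (show t + 1 ≤ finrank K S from e).eq_or_lt with e' | e'
  swap
  -- Smallest covers of dimension at least t+2 force two or more branching steps in F from T,
  -- bringing N_a(t+2) into the bound.
  · exfalso
    have h3 := ncard_star_le_pow_mul_isoNum hB hN hV h.cross.symm h.subset_right h.subset_left
      (by omega) hmin hT.2 htS
    rw [star_eq_self hTF] at h3
    have p₄ := mul_nonneg p₁.le p₃.le
    have h4 := pow_mul_isoNum_le hq (ν := ν) (s := t + 2) (m := a) (τ := finrank K S) p₄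
      (fun k hk hka => by
        simpa using two_pow_mul_three_qNum_le hq (k := 0) (x := t + 1) (y := b - t + 1)
          (z := a - k) (n := 2 * (ν - k)) (by omega)) e'
    have h5 : (F.ncard : ℝ) * G.ncard ≤ (qNum 𝔮 (t + 1) * qNum 𝔮 (b - t + 1)) ^ 2
        * (isoNum 𝔮 ν (t + 2) a * isoNum 𝔮 ν t b) := by
      have n₅ := isoNum_nonneg hq ν (finrank K S) a
      calc (F.ncard : ℝ) * G.ncard ≤ _ := mul_le_mul h3 hGle (by positivity) (by positivity)
        _ = (qNum 𝔮 (t + 1) * qNum 𝔮 (b - t + 1)) ^ 2 * ((qNum 𝔮 (t + 1) * qNum 𝔮 (b - t + 1))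
              ^ (finrank K S - (t + 2)) * isoNum 𝔮 ν (finrank K S) a * isoNum 𝔮 ν t b) := by
            rw [show finrank K S - t = 2 + (finrank K S - (t + 2)) by omega, pow_add, pow_add]
            ring
        _ ≤ _ := mul_le_mul_of_nonneg_left
            (mul_le_mul_of_nonneg_right h4 n₃.le) (by positivity)
    rcases le_total (2 * t) b with hbt | hbt
    · have h6 := mul_isoNum_succ_le hq (ν := ν) (k := t + 1) (m := a)
        (x := 2 ^ 1 * (qNum 𝔮 (t + 1) * qNum 𝔮 (t + 1) * qNum 𝔮 (b - t + 1))) fun _ => by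
          have := two_pow_mul_four_qNum_le hq (k := 1) (w := t + 1) (x := t + 1)
            (y := b - t + 1) (z := a - (t + 1)) (n := 2 * (ν - (t + 1))) (by omega)
          linarith
      have h7 := mul_le_mul_of_nonneg_left h6 (mul_nonneg p₃.le n₃.le)
      nlinarith
    · have h6 := mul_isoNum_succ_le hq (ν := ν) (k := t + 1) (m := a)
        (x := 2 ^ 1 * (qNum 𝔮 (t + 1) * qNum 𝔮 (b - t + 1) * qNum 𝔮 (b - t + 1))) fun _ => by
          have := two_pow_mul_four_qNum_le hq (k := 1) (w := t + 1) (x := b - t + 1)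
            (y := b - t + 1) (z := a - (t + 1)) (n := 2 * (ν - (t + 1))) (by omega)
          linarith
      have h7 := mul_le_mul_of_nonneg_left h6 (mul_nonneg p₁.le n₃.le)
      nlinarith
  rw [← e', Nat.add_sub_cancel_left, pow_one] at hGle
  -- A (t+1)-space X common to F either covers G, which is the C₃, C₄ configuration, or permits a
  -- further branching step and makes F too small.
  by_cases hX : ∃ X : Submodule K V, finrank K X = t + 1 ∧ ∀ A ∈ F, X ≤ A
  · obtain ⟨X, hXd, hXF⟩ := hX
    by_cases hXc : IsCover B t G X
    · exact Or.inr ⟨X, ⟨hXc.1, hXd⟩, fun A hA => ⟨h.subset_left hA, hXF A hA⟩,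
        fun C hC => ⟨h.subset_right hC, by rw [inf_comm]; exact hXc.2 C hC⟩⟩
    exfalso
    have h3 := ncard_star_le_of_not_isCover h.cross.symm h.subset_right h.subset_left (by omega)
      hXc n₄ fun Y hY => ncard_star_le_isoNum hB hN hV h.subset_left (by rw [hY, hXd])
    rw [star_eq_self hXF] at h3
    have h5 := mul_le_mul h3 hGle (by positivity) (by positivity)
    rcases le_total (2 * t) b with hbt | hbt
    · have h6 := mul_isoNum_succ_le hq (ν := ν) (k := t + 1) (m := a)
        (x := 2 ^ 1 * qNum 𝔮 (t + 1)) fun _ => by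
          have := two_pow_mul_qNum_mul_qNum_le hq (k := 1) (x := t + 1)
            (y := a - (t + 1)) (n := 2 * (ν - (t + 1))) (by omega)
          linarith
      have h7 := mul_le_mul_of_nonneg_left h6 (mul_nonneg p₃.le n₃.le)
      nlinarith
    · have h6 := mul_isoNum_succ_le hq (ν := ν) (k := t + 1) (m := a)
        (x := 2 ^ 1 * qNum 𝔮 (b - t + 1)) fun _ => by
          have := two_pow_mul_qNum_mul_qNum_le hq (k := 1) (x := b - t + 1)
            (y := a - (t + 1)) (n := 2 * (ν - (t + 1))) (by omega)
          linarith
      have h7 := mul_le_mul_of_nonneg_left h6 (mul_nonneg p₁.le n₃.le)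
      nlinarith
  -- A second t-dimensional cover W of F would put a (t+1)-subspace of W ⊔ T into every member of F.
  have huniq : ∀ W : Submodule K V, finrank K W = t → IsCover B t F W → W = T := by
    intro W hW hc
    by_contra hne
    have hWT : ¬ W ≤ T := fun hle => hne (Submodule.eq_of_le_of_finrank_eq hle (by rw [hW, hT.2]))
    have h3 := finrank_lt_finrank_sup hWT
    rw [hT.2] at h3
    obtain ⟨X, hXle, hXd⟩ := exists_le_finrank_eq (Z := W ⊔ T) (n := t + 1) h3
    exact hX ⟨X, hXd, fun A hA => hXle.trans (sup_le (hc.forall_le hW A hA) (hTF A hA))⟩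
  -- If a (t+1)-cover of G misses T, none of its t-subspaces covers F, so all their stars in G are
  -- small.
  by_cases hcT : ∃ S', IsCover B t G S' ∧ finrank K S' = t + 1 ∧ ¬ T ≤ S'
  · obtain ⟨S', hS', hS'd, hTS'⟩ := hcT
    exfalso
    have h3 := ncard_le_of_isCover hS' (by omega) (mul_nonneg p₂.le n₂.le) fun W hWS hW =>
      hstar W hW fun hc => hTS' (huniq W hW hc ▸ hWS)
    rw [hS'd, Nat.add_sub_cancel_left, pow_one, ← mul_assoc] at h3
    refine small (mul_nonneg p₁.le p₂.le) h3 ?_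
    simpa using two_pow_mul_three_qNum_le hq (k := 1) (x := t + 1) (y := a - t + 1) (z := b - t)
      (n := 2 * (ν - t)) (by omega)
  push Not at hcT
  -- All (t+1)-covers of G contain T, so M lies in the (b+1)-space T ⊔ C for each C in G not
  -- containing T. Dimension b+1 for M makes all these spaces equal to M; smaller M makes F too
  -- small.
  set M : Submodule K V := sSup {S' | IsCover B t G S' ∧ finrank K S' = t + 1}
  have hcov : ∀ S', IsCover B t G S' → finrank K S' = t + 1 → S' ≤ M := fun S' h1 h2 =>
    le_sSup ⟨h1, h2⟩
  have hTM : T ≤ M := (hcT S hSc e'.symm).trans (hcov S hSc e'.symm)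
  have hsup : ∀ C ∈ G, ¬ T ≤ C → M ≤ T ⊔ C ∧ finrank K ↥(T ⊔ C) = b + 1 := fun C hC hTC =>
    ⟨sSup_le fun S' hS' => (le_sup_of_isCover h.subset_right hC hTC hS'.1 hS'.2
      (hcT S' hS'.1 hS'.2)).1, (le_sup_of_isCover h.subset_right hC hTC hSc e'.symm
      (hcT S hSc e'.symm)).2⟩
  obtain ⟨C₀, hC₀, hTC₀⟩ : ∃ C₀ ∈ G, ¬ T ≤ C₀ := by
    by_contra! hall
    exact hTG (isCover_of_forall_le hT hall)
  rcases lt_or_ge b (finrank K M) with hMb | hMb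
  · left
    have hMsup : ∀ C ∈ G, ¬ T ≤ C → T ⊔ C = M := fun C hC hTC =>
      (Submodule.eq_of_le_of_finrank_le (hsup C hC hTC).1
        (by rw [(hsup C hC hTC).2]; exact hMb)).symm
    have hMd : finrank K M = b + 1 := by
      rw [← hMsup C₀ hC₀ hTC₀]; exact (hsup C₀ hC₀ hTC₀).2
    have hMT : M ≤ B.orthogonal T := sSup_le fun S' hS' =>
      hS'.1.1.le_orthogonal (hcT S' hS'.1 hS'.2)
    obtain ⟨r1, r2, r3, r4⟩ := subset_C₁_and_subset_C₂ hB h.subset_left h.subset_right h.cross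
      hT hTF hC₀ hTC₀ hMsup hMd hMT
    exact ⟨M, r1, T, hT, r2, r3, r4⟩
  · exfalso
    have h3 := ncard_le_of_covers_le hB hN hV htb h₁ h.cross h.subset_left h.subset_right hT
      hTF hTG hTM hMb hcov
    set G' : Set (Submodule K V) := {C ∈ G | ¬ T ≤ C}
    have hGG : G ⊆ star G T ∪ G' := fun C hC => by
      by_cases hTC : T ≤ C
      · exact Or.inl ⟨hC, hTC⟩
      · exact Or.inr ⟨hC, hTC⟩
    have hcard : (G.ncard : ℝ) ≤ (star G T).ncard + G'.ncard := by
      exact_mod_cast (Set.ncard_le_ncard hGG (Set.toFinite _)).trans (Set.ncard_union_le _ _)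
    have h4 : ((star G T).ncard : ℝ) ≤ isoNum 𝔮 ν t b :=
      ncard_star_le_isoNum hB hN hV h.subset_right hT.2
    have hSG' : IsCover B t G' S := ⟨hSc.1, fun C hC => hSc.2 C hC.1⟩
    have h5 := ncard_le_of_isCover hSG' htS (mul_nonneg p₂.le n₂.le) fun W _ hW => by
      by_cases hWT : W = T
      · have : star G' W = ∅ := by
          rw [Set.eq_empty_iff_forall_notMem]
          exact fun C hC => hC.1.2 (hWT ▸ hC.2)
        rw [this, Set.ncard_empty, Nat.cast_zero]
        exact mul_nonneg p₂.le n₂.le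
      · have hs : star G' W ⊆ star G W := fun C hC => ⟨hC.1.1, hC.2⟩
        refine le_trans ?_ (hstar W hW fun hc => hWT (huniq W hW hc))
        exact_mod_cast Set.ncard_le_ncard hs (Set.toFinite _)
    rw [← e', Nat.add_sub_cancel_left, pow_one, ← mul_assoc] at h5
    have h6 := mul_isoNum_succ_le hq (ν := ν) (k := t) (m := b)
      (x := 2 ^ 3 * (qNum 𝔮 (t + 1) * qNum 𝔮 (a - t + 1))) fun _ => by
        have := two_pow_mul_three_qNum_le hq (k := 3) (x := t + 1) (y := a - t + 1)
          (z := b - t) (n := 2 * (ν - t)) (by omega)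
        linarith
    -- Members of G missing T add at most 1/8 to the star of T, and 5/8 · 9/8 = 45/64 < 3/4.
    have h7 : 8 * (G.ncard : ℝ) ≤ 9 * isoNum 𝔮 ν t b := by linarith
    have h8 := mul_le_mul h3 h7 (by positivity) (by positivity)
    nlinarith

end Structure

/-! ### Numerical comparison of the candidate products -/

section Comparisons

variable {q : ℝ} {ν t a b : ℕ}

theorem one_le_isoNum (hq : 2 ≤ q) {k m : ℕ} (hkm : k ≤ m) (hm : m ≤ ν) :
    1 ≤ isoNum q ν k m := by
  rw [isoNum, if_pos hkm]
  refine Finset.prod_induction _ (fun x => (1 : ℝ) ≤ x) (fun x y => one_le_mul_of_one_le_of_one_le)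
    le_rfl fun i hi => ?_
  rw [Finset.mem_Ico] at hi
  rw [one_le_div (qNum_pos hq (by omega))]
  exact qNum_mono hq (by omega)

/-- Both sides equal [2(ν-t)]·N_a(t+1)·N_b(t+1). This measures the effect of exchanging the two
dimensions. -/
theorem isoNum_mul_comm (hq : 2 ≤ q) :
    isoNum q ν (t + 1) b * isoNum q ν t a * qNum q (a - t)
      = isoNum q ν (t + 1) a * isoNum q ν t b * qNum q (b - t) := by
  linear_combination isoNum q ν (t + 1) b * isoNum_mul_qNum hq ν t a
    - isoNum q ν (t + 1) a * isoNum_mul_qNum hq ν t b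

/-- The size of the pair `C₃, C₄`, up to lower order terms. -/
theorem three_mul_le_four_mul_C₃_C₄ (hq : 2 ≤ q) (h₁ : b + t + 2 ≤ 2 * ν) :
    3 * (qNum q (t + 1) * (isoNum q ν (t + 1) a * isoNum q ν t b))
      ≤ 4 * (isoNum q ν (t + 1) a
        * (qNum q (t + 1) * isoNum q ν t b - q * qNum q t * isoNum q ν (t + 1) b)) := by
  -- The subtracted term is at most [t+1]·N_b(t+1), a quarter of the main term.
  have h := mul_isoNum_succ_le hq (ν := ν) (k := t) (m := b) (x := 2 ^ 2) fun _ =>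
    (two_pow_mul_qNum_le hq 2 (b - t)).trans (qNum_mono hq (by omega))
  have n₁ := isoNum_nonneg hq ν (t + 1) a
  have n₂ := isoNum_nonneg hq ν (t + 1) b
  have h3 := qNum_succ q t
  have p := qNum_nonneg hq (t + 1)
  have h4 := mul_le_mul_of_nonneg_left h p
  have h5 : q * qNum q t * isoNum q ν (t + 1) b ≤ qNum q (t + 1) * isoNum q ν (t + 1) b :=
    mul_le_mul_of_nonneg_right (by linarith) n₂
  nlinarith

/-- The size of the pair `C₁, C₂`, up to lower order terms. -/
theorem three_mul_le_four_mul_C₁_C₂ (hq : 2 ≤ q) (htb : t ≤ b)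
    (h₁ : a + b + 3 ≤ 2 * ν) {c₁ c₂ : ℝ}
    (hc₁ : qNum q (b - t + 1) * ((q + 1) * isoNum q ν (t + 1) a
      - q * qNum q (b - t) * isoNum q ν (t + 2) a) ≤ (q + 1) * c₁)
    (hc₂ : isoNum q ν t b ≤ c₂) :
    3 * (qNum q (b - t + 1) * (isoNum q ν (t + 1) a * isoNum q ν t b)) ≤ 4 * (c₁ * c₂) := by
  have h := mul_isoNum_succ_le hq (ν := ν) (k := t + 1) (m := a)
    (x := 2 ^ 2 * qNum q (b - t)) fun _ => by
      have := two_pow_mul_qNum_mul_qNum_le hq (k := 2) (x := b - t) (y := a - (t + 1))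
        (n := 2 * (ν - (t + 1))) (by omega)
      linarith
  have n₁ := isoNum_nonneg hq ν (t + 1) a
  have n₂ := isoNum_nonneg hq ν t b
  have n₃ := isoNum_nonneg hq ν (t + 2) a
  have p := qNum_nonneg hq (b - t + 1)
  have p' := qNum_nonneg hq (b - t)
  have h3 : 4 * (q * qNum q (b - t) * isoNum q ν (t + 2) a) ≤ (q + 1) * isoNum q ν (t + 1) a := by
    have : 0 ≤ qNum q (b - t) * isoNum q ν (t + 2) a := mul_nonneg p' n₃
    nlinarith
  have h4 := mul_le_mul_of_nonneg_left h3 p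
  have h5 : 3 * (qNum q (b - t + 1) * isoNum q ν (t + 1) a) ≤ 4 * c₁ := by
    have : 0 < q + 1 := by linarith
    refine le_of_mul_le_mul_left ?_ this
    nlinarith
  have h6 : 0 ≤ 4 * c₁ := le_trans (by positivity) h5
  have h7 := mul_le_mul h5 hc₂ n₂ h6
  linarith

/-- The pair `C₁, C₂` beats the one with the roles of the dimensions exchanged. -/
theorem C₁_C₂_swap_lt (hq : 2 ≤ q) (ht : 1 ≤ t) (htb : t + 1 ≤ b) (hba : b < a)
    (h₁ : 2 * a + b + t + 3 ≤ 2 * ν) {c₁ c₂ c₁' c₂' : ℝ}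
    (hc₁ : qNum q (b - t + 1) * ((q + 1) * isoNum q ν (t + 1) a
      - q * qNum q (b - t) * isoNum q ν (t + 2) a) ≤ (q + 1) * c₁)
    (hc₂ : isoNum q ν t b ≤ c₂)
    (hc₁' : c₁' ≤ qNum q (a - t + 1) * isoNum q ν (t + 1) b)
    (hc₂' : c₂' ≤ isoNum q ν t a + qNum q (a + 1)) (hc₂'' : 0 ≤ c₂') : c₁' * c₂' < c₁ * c₂ := by
  have h := mul_isoNum_succ_le hq (ν := ν) (k := t + 1) (m := a)
    (x := 2 ^ 3 * (qNum q (b - t + 1) * qNum q (b - t))) fun _ => by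
      have := two_pow_mul_three_qNum_le hq (k := 3) (x := b - t + 1) (y := b - t)
        (z := a - (t + 1)) (n := 2 * (ν - (t + 1))) (by omega)
      linarith
  have hD := two_pow_mul_three_qNum_le hq (k := 2) (x := a - t + 1) (y := b - t)
        (z := a + 1) (n := 2 * (ν - t)) (by omega)
  have hA := isoNum_mul_qNum hq ν t a
  have hB := isoNum_mul_qNum hq ν t b
  have huw := two_pow_mul_qNum_le hq 1 (b - t)
  have huw' := huw.trans (qNum_mono hq (show 1 + (b - t) ≤ a - t by omega))
  have hu := qNum_succ q (a - t)
  have hw := qNum_succ q (b - t)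
  have pu := qNum_pos hq (show 1 ≤ a - t by omega)
  have pw := qNum_pos hq (show 1 ≤ b - t by omega)
  have pa := qNum_pos hq (show 1 ≤ a + 1 by omega)
  have pD := qNum_pos hq (show 1 ≤ 2 * (ν - t) by omega)
  have pu1 := qNum_pos hq (show 1 ≤ a - t + 1 by omega)
  have pw1 := qNum_pos hq (show 1 ≤ b - t + 1 by omega)
  have hw1 := one_le_qNum hq (show 1 ≤ b - t + 1 by omega)
  have hA1 := one_le_isoNum (ν := ν) hq (show t + 1 ≤ a by omega) (by omega)
  have hB1 := one_le_isoNum (ν := ν) hq htb (by omega)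
  have hB0 := isoNum_nonneg hq ν t b
  have hA2 := isoNum_nonneg hq ν (t + 2) a
  generalize isoNum q ν t a = A0 at *
  generalize isoNum q ν (t + 1) a = A1 at *
  rw [show t + 1 + 1 = t + 2 by rfl] at h
  generalize isoNum q ν (t + 2) a = A2 at *
  generalize isoNum q ν t b = B0 at *
  generalize isoNum q ν (t + 1) b = B1 at *
  generalize qNum q (2 * (ν - t)) = D at *
  generalize qNum q (a + 1) = e at *
  generalize qNum q (a - t + 1) = u1 at *
  generalize qNum q (b - t + 1) = w1 at *
  generalize qNum q (a - t) = u at *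
  generalize qNum q (b - t) = w at *
  -- The 1/8 comes from `h`, which says 8·w1·w·A2 ≤ A1.
  have k1 : (w1 - 1 / 8) * A1 ≤ c₁ := by
    have hq1 : 0 < q + 1 := by linarith
    refine le_of_mul_le_mul_left ?_ hq1
    have : q * (w1 * w * A2) ≤ (q + 1) * (A1 / 8) := by
      have h0 : 0 ≤ w1 * w * A2 := by positivity
      nlinarith
    nlinarith
  have k2 : (w1 - 1 / 8) * A1 * B0 ≤ c₁ * c₂ :=
    mul_le_mul k1 hc₂ hB0 (le_trans (mul_nonneg (by linarith) (by linarith)) k1)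
  have k3 : c₁' * c₂' ≤ u1 * B1 * (A0 + e) := mul_le_mul hc₁' hc₂' hc₂'' (by positivity)
  refine k3.trans_lt (lt_of_lt_of_le ?_ k2)
  have puw : 0 < u * w := mul_pos pu pw
  refine lt_of_mul_lt_mul_right ?_ puw.le
  have e1 : u1 * B1 * (A0 + e) * (u * w) = u1 * w * B1 * (D * A1) + u1 * w * e * (u * B1) := by
    rw [← hA]; ring
  have e2 : (w1 - 1 / 8) * A1 * B0 * (u * w) = (w1 - 1 / 8) * u * A1 * (D * B1) := by
    rw [← hB]; ring
  rw [e1, e2]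
  have k4 : u1 * w * e * (u * B1) ≤ D / 4 * (u * B1) :=
    mul_le_mul_of_nonneg_right (by linarith) (by positivity)
  have k5 : D / 4 * (u * B1) ≤ D / 4 * (u * B1) * A1 :=
    le_mul_of_one_le_right (by positivity) hA1
  have k6 : 0 < D * A1 * B1 := by positivity
  -- With u1 = qu + 1 and w1 = qw + 1 the terms quw cancel, leaving w < 5u/8, which follows from 2w
  -- ≤ u.
  have k7 : u1 * w + u / 4 < (w1 - 1 / 8) * u := by
    rw [hu, hw]
    nlinarith
  have k8 := mul_lt_mul_of_pos_right k7 k6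
  nlinarith

/-- Here [b-t+1] ≤ [t], while the C₃, C₄ side has [t+1] = [t] + q^t. The surplus q^t·N_b(t)
outweighs the lower-order terms [t]·([b+1] + q·N_b(t+1)). -/
theorem C₁_C₂_lt_C₃_C₄_of_lt (hq : 2 ≤ q) (htb : t + 1 ≤ b) (hbt : b < 2 * t)
    (hta : t + 1 ≤ a) (haν : a ≤ ν) (h₂ : 3 * b + t + 3 ≤ 2 * ν) {c₁ c₂ : ℝ}
    (hc₁ : c₁ ≤ qNum q (b - t + 1) * isoNum q ν (t + 1) a)
    (hc₂ : c₂ ≤ isoNum q ν t b + qNum q (b + 1)) (hc₂' : 0 ≤ c₂) :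
    c₁ * c₂ < isoNum q ν (t + 1) a
        * (qNum q (t + 1) * isoNum q ν t b - q * qNum q t * isoNum q ν (t + 1) b) := by
  have h := mul_isoNum_succ_le hq (ν := ν) (k := t) (m := b) (x := 2 ^ 2 * qNum q (b + 1))
    fun _ => by
      have := two_pow_mul_qNum_mul_qNum_le hq (k := 2) (x := b + 1) (y := b - t)
        (n := 2 * (ν - t)) (by omega)
      linarith
  have hqb := qNum_mono hq (show 2 ≤ b + 1 by omega)
  rw [qNum_succ, qNum_one] at hqb
  have hA1 := isoNum_pos (ν := ν) hq hta haν
  have hB1 := one_le_isoNum (ν := ν) hq htb (by omega)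
  have hwt := qNum_mono hq (show b - t + 1 ≤ t by omega)
  have hpt := qNum_pos hq (show 1 ≤ t by omega)
  have htp := qNum_le_pow hq t
  rw [qNum_succ_pow]
  generalize isoNum q ν (t + 1) a = A1 at *
  generalize isoNum q ν t b = B0 at *
  generalize isoNum q ν (t + 1) b = B1 at *
  have pe : 0 ≤ qNum q (b + 1) := qNum_nonneg hq _
  generalize qNum q (b + 1) = e at *
  have k1 : c₁ * c₂ ≤ qNum q t * A1 * (B0 + e) :=
    mul_le_mul (hc₁.trans (mul_le_mul_of_nonneg_right hwt hA1.le)) hc₂ hc₂' (by positivity)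
  refine k1.trans_lt ?_
  have k2 : e ≤ e * B1 := le_mul_of_one_le_right pe hB1
  have k3 : q * B1 ≤ e * B1 := mul_le_mul_of_nonneg_right (by linarith) (by linarith)
  have k4 : 0 < e * B1 := mul_pos (by linarith) (by linarith)
  have k5 : e + q * B1 < B0 := by linarith
  have k6 := mul_lt_mul_of_pos_left k5 (mul_pos hpt hA1)
  have k7 : qNum q t * A1 * B0 ≤ q ^ t * A1 * B0 :=
    mul_le_mul_of_nonneg_right (mul_le_mul_of_nonneg_right htp hA1.le) (by linarith)
  nlinarith

/-- At b = 2t the leading terms coincide, so the overlap q[t]·N_a(t+2) lost by C₁ is set against the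
overlap lost by C₄ plus the gain [2t+1] in C₂. This is why the upper bound for c₁ must keep its
second term. -/
theorem C₁_C₂_lt_C₃_C₄_of_eq (hq : 2 ≤ q) (ht : 1 ≤ t) (hta : 2 * t ≤ a)
    (hta' : t = 1 → 4 ≤ a) (h₁ : 2 * a + 3 * t + 3 ≤ 2 * ν) {c₁ c₂ : ℝ}
    (hc₁ : c₁ ≤ qNum q (t + 1) * isoNum q ν (t + 1) a - q * qNum q t * isoNum q ν (t + 2) a)
    (hc₁' : 0 ≤ c₁)
    (hc₂ : c₂ ≤ isoNum q ν t (2 * t) + qNum q (2 * t + 1)) :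
    c₁ * c₂ < isoNum q ν (t + 1) a
      * (qNum q (t + 1) * isoNum q ν t (2 * t) - q * qNum q t * isoNum q ν (t + 1) (2 * t)) := by
  have hB := isoNum_mul_qNum hq ν t (2 * t)
  have hA := isoNum_mul_qNum hq ν (t + 1) a
  have hA1 := isoNum_pos (ν := ν) hq (show t + 1 ≤ a by omega) (by omega)
  have hA2 := isoNum_nonneg hq ν (t + 2) a
  have hB0 := isoNum_nonneg hq ν t (2 * t)
  have hB1 := one_le_isoNum (ν := ν) hq (show t + 1 ≤ 2 * t by omega) (by omega)
  have hD := pow_mul_qNum_le hq 2 (2 * (ν - (t + 1)))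
  rw [show 2 + 2 * (ν - (t + 1)) = 2 * (ν - t) by omega] at hD
  rw [show 2 * t - t = t by omega] at hB
  have pt := qNum_pos hq ht
  have pe := qNum_nonneg hq (2 * t + 1)
  have key : qNum q (t + 1) * qNum q (2 * t + 1) + q * qNum q t * isoNum q ν (t + 1) (2 * t)
      < q ^ 3 * qNum q (a - (t + 1)) * isoNum q ν (t + 1) (2 * t) := by
    -- For t = 1 the claim is (q+1)(q²+q+1) + q < q³·[a-2], true from a = 4 on; this is where the
    -- exceptional triples drop out. For t ≥ 2 the product [t+1]·[2t+1] is absorbed by N_{2t}(t+1).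
    rcases ht.eq_or_lt with rfl | ht2
    · have h4 := qNum_mono hq (show 2 ≤ a - (1 + 1) by have := hta' rfl; omega)
      rw [show 2 * 1 = 1 + 1 by rfl, isoNum_self]
      simp only [qNum_succ, qNum_zero] at h4 ⊢
      have h5 := mul_le_mul_of_nonneg_left h4 (show (0 : ℝ) ≤ q ^ 3 by positivity)
      nlinarith [mul_nonneg (show (0 : ℝ) ≤ q ^ 2 by positivity) (show 0 ≤ q - 2 by linarith),
        mul_nonneg (show (0 : ℝ) ≤ q ^ 3 by positivity) (show 0 ≤ q - 2 by linarith)]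
    · have h4 := qNum_mono hq (show t - 1 ≤ a - (t + 1) by omega)
      have h5 := qNum_succ q (t - 1)
      rw [show t - 1 + 1 = t by omega] at h5
      have h6 := qNum_mono hq (show 2 ≤ t by omega)
      simp only [qNum_succ q 1, qNum_one] at h6
      have h7 := mul_isoNum_succ_le hq (ν := ν) (k := t + 1) (m := 2 * t)
        (x := qNum q (t + 1) * qNum q (2 * t + 1)) fun _ => by
          simpa using two_pow_mul_three_qNum_le hq (k := 0) (x := t + 1) (y := 2 * t + 1)
            (z := 2 * t - (t + 1)) (n := 2 * (ν - (t + 1))) (by omega)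
      have h8 := one_le_isoNum (ν := ν) hq (show t + 1 + 1 ≤ 2 * t by omega) (by omega)
      have h9 := mul_nonneg (qNum_nonneg hq (t + 1)) pe
      have h10 : qNum q (t + 1) * qNum q (2 * t + 1) ≤ isoNum q ν (t + 1) (2 * t) :=
        (le_mul_of_one_le_right h9 h8).trans h7
      have h11 : q * qNum q t + 2 ≤ q ^ 3 * qNum q (a - (t + 1)) := by
        have h12 := mul_le_mul_of_nonneg_left h4 (show (0 : ℝ) ≤ q ^ 3 by positivity)
        have h13 : q ^ 3 * qNum q (t - 1) = q ^ 2 * (qNum q t - 1) := by rw [h5]; ring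
        rw [h13] at h12
        nlinarith [mul_nonneg (show 0 ≤ q * (q - 1) by nlinarith)
          (show 0 ≤ qNum q t - (q * 1 + 1) by linarith),
          mul_nonneg (show 0 ≤ q - 2 by linarith) (show 0 ≤ q - 2 by linarith),
          mul_nonneg (mul_nonneg (show 0 ≤ q by linarith) (show 0 ≤ q by linarith))
            (show 0 ≤ q - 2 by linarith)]
      have h14 := mul_le_mul_of_nonneg_right h11 (show 0 ≤ isoNum q ν (t + 1) (2 * t) by linarith)
      nlinarith
  have k1 : c₁ * c₂ ≤ (qNum q (t + 1) * isoNum q ν (t + 1) a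
      - q * qNum q t * isoNum q ν (t + 2) a) * (isoNum q ν t (2 * t) + qNum q (2 * t + 1)) :=
    (mul_le_mul_of_nonneg_left hc₂ hc₁').trans
      (mul_le_mul_of_nonneg_right hc₁ (by positivity))
  refine k1.trans_lt ?_
  rw [show t + 1 + 1 = t + 2 by rfl] at hA
  -- Apply the recurrence to both factors, together with q²·[2(ν-t-1)] ≤ [2(ν-t)].
  have k2 : q ^ 3 * qNum q (a - (t + 1)) * isoNum q ν (t + 1) (2 * t) * isoNum q ν (t + 1) a
      ≤ q * qNum q t * isoNum q ν (t + 2) a * isoNum q ν t (2 * t) := by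
    have h4 := mul_le_mul_of_nonneg_right hD
      (show 0 ≤ q * isoNum q ν (t + 2) a * isoNum q ν (t + 1) (2 * t) by positivity)
    calc _ = q ^ 3 * isoNum q ν (t + 1) (2 * t)
          * (isoNum q ν (t + 1) a * qNum q (a - (t + 1))) := by ring
      _ = q ^ 2 * qNum q (2 * (ν - (t + 1)))
          * (q * isoNum q ν (t + 2) a * isoNum q ν (t + 1) (2 * t)) := by rw [hA]; ring
      _ ≤ _ := h4
      _ = q * isoNum q ν (t + 2) a * (isoNum q ν t (2 * t) * qNum q t) := by rw [hB]; ring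
      _ = _ := by ring
  have k3 := mul_lt_mul_of_pos_right key hA1
  have k4 : 0 ≤ q * qNum q t * isoNum q ν (t + 2) a * qNum q (2 * t + 1) := by positivity
  nlinarith

/-- For t = 1 and b = 2 the counts are explicit: with D' = [2(ν-2)], N_2(1) = q²D' + q + 1, and
N_3(2) = D'. The q² extra lines in C₂ tip the balance; for a = 3 the excess is at least (q²+q)D' -
(q³+q²+q), positive since D' ≥ [3]. -/
theorem C₃_C₄_lt_C₁_C₂_of_special (hq : 2 ≤ q) (ha : a = 2 ∨ a = 3) (hν : 4 ≤ ν) {c₁ c₂ : ℝ}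
    (hc₁ : qNum q 2 * ((q + 1) * isoNum q ν 2 a - q * isoNum q ν 3 a) ≤ (q + 1) * c₁)
    (hc₂ : isoNum q ν 1 2 + q ^ 2 ≤ c₂) :
    isoNum q ν 2 a * (qNum q 2 * isoNum q ν 1 2 - q * isoNum q ν 2 2) < c₁ * c₂ := by
  have hB := isoNum_mul_qNum hq ν 1 2
  have hA := isoNum_mul_qNum hq ν 2 a
  have e2 : qNum q 2 = q + 1 := by rw [qNum_succ, qNum_one, mul_one]
  have hD' := qNum_mono hq (show 3 ≤ 2 * (ν - 2) by omega)
  have e3 : qNum q (2 * (ν - 1)) = q * (q * qNum q (2 * (ν - 2)) + 1) + 1 := by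
    rw [show 2 * (ν - 1) = 2 * (ν - 2) + 1 + 1 by omega, qNum_succ, qNum_succ]
  rw [isoNum_self] at hB ⊢
  rw [show 2 - 1 = 1 by rfl, qNum_one, e3, mul_one, mul_one] at hB
  rw [qNum_succ q 2, e2] at hD'
  rw [e2] at hc₁ ⊢
  have k1 : (q + 1) * isoNum q ν 2 a - q * isoNum q ν 3 a ≤ c₁ :=
    le_of_mul_le_mul_left hc₁ (by linarith)
  rw [hB] at hc₂ ⊢
  generalize qNum q (2 * (ν - 2)) = D' at *
  rcases ha with rfl | rfl
  · rw [isoNum_self, isoNum_of_lt q ν (by omega : 2 < 3)] at k1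
    rw [isoNum_self]
    have k2 : q + 1 ≤ c₁ := by linarith
    have k3 := mul_le_mul k2 hc₂ (by nlinarith) (by linarith)
    nlinarith
  · rw [show 3 - 2 = 1 by rfl, qNum_one, isoNum_self] at hA
    rw [isoNum_self] at k1
    have hA' : isoNum q ν 2 3 = D' := by linarith
    rw [hA'] at k1 ⊢
    have k3 : ((q + 1) * D' - q * 1) * (q * (q * D' + 1) + 1 + q ^ 2) ≤ c₁ * c₂ :=
      mul_le_mul k1 hc₂ (by nlinarith) (le_trans (by nlinarith) k1)
    refine lt_of_lt_of_le ?_ k3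
    nlinarith [mul_le_mul_of_nonneg_left hD' (show 0 ≤ q ^ 2 + q by positivity),
      mul_nonneg (show 0 ≤ q ^ 3 by positivity) (show 0 ≤ q by linarith), sq_nonneg q]

end Comparisons

/-! ### Maximum pairs: classification and exclusion -/

section Maximal

variable {K V : Type*} [Field K] [AddCommGroup V] [Module K V]
  {B : LinearMap.BilinForm K V} {ν t a b : ℕ} {F G : Set (Submodule K V)}

theorem IsMaxNontrivialCross.symm (h : IsMaxNontrivialCross B a b t F G) :
    IsMaxNontrivialCross B b a t G F :=
  ⟨h.1.symm, fun G₁ G₂ hG => by rw [mul_comm, mul_comm G.ncard]; exact h.2 G₂ G₁ hG.symm⟩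

theorem IsMaxNontrivialCross.le (h : IsMaxNontrivialCross B a b t F G)
    {F' G' : Set (Submodule K V)} (h' : IsNontrivialCross B a b t F' G') :
    (F'.ncard : ℝ) * G'.ncard ≤ (F.ncard : ℝ) * G.ncard := by
  exact_mod_cast h.2 F' G' h'

variable [Finite V]

/-- Non-emptiness matters: enlarging one family increases the product only if the other is
non-empty. -/
theorem IsMaxNontrivialCross.eq_of_subset (h : IsMaxNontrivialCross B a b t F G)
    (hF : F.Nonempty) (hG : G.Nonempty) {F' G' : Set (Submodule K V)}
    (h' : IsNontrivialCross B a b t F' G') (hFF : F ⊆ F') (hGG : G ⊆ G') : F = F' ∧ G = G' := by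
  have h1 := h.2 F' G' h'
  have h2 := Set.ncard_le_ncard hFF (Set.toFinite _)
  have h3 := Set.ncard_le_ncard hGG (Set.toFinite _)
  have h4 := (Set.ncard_pos (Set.toFinite F)).2 hF
  have h5 := (Set.ncard_pos (Set.toFinite G)).2 hG
  constructor
  · refine Set.eq_of_subset_of_ncard_le hFF ?_ (Set.toFinite _)
    by_contra! hlt
    have := Nat.mul_lt_mul_of_lt_of_le hlt h3 (by omega)
    omega
  · refine Set.eq_of_subset_of_ncard_le hGG ?_ (Set.toFinite _)
    by_contra! hlt
    have := Nat.mul_lt_mul_of_le_of_lt h2 hlt (by omega)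
    omega

variable [Finite K]

local notation "𝔮" => ((Nat.card K : ℕ) : ℝ)

theorem IsMaxNontrivialCross.C₃_C₄_le (hB : B.IsAlt) (hN : B.Nondegenerate)
    (hV : finrank K V = 2 * ν) (ht : 1 ≤ t) (htb : t + 1 ≤ b) (hb : b ≤ ν)
    (h : IsMaxNontrivialCross B a b t F G) :
    isoNum 𝔮 ν (t + 1) a
        * (qNum 𝔮 (t + 1) * isoNum 𝔮 ν t b - 𝔮 * qNum 𝔮 t * isoNum 𝔮 ν (t + 1) b)
      ≤ (F.ncard : ℝ) * G.ncard := by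
  obtain ⟨S, hS⟩ := exists_isotropicSubspaces hB hN hV (show t + 1 ≤ ν by omega)
  have h1 := h.le (isNontrivialCross_C₃_C₄ hB hN hV ht htb hb hS)
  rwa [ncard_C₃ hB hN hV hS, ncard_C₄ hB hN hV hS] at h1

theorem IsMaxNontrivialCross.exists_C₁_C₂_le (hB : B.IsAlt) (hN : B.Nondegenerate)
    (hV : finrank K V = 2 * ν) (ht : 1 ≤ t) (htb : t + 1 ≤ b) (hb : b + 1 ≤ ν)
    (h : IsMaxNontrivialCross B a b t F G) :
    ∃ c₁ c₂ : ℝ, qNum 𝔮 (b - t + 1) * ((𝔮 + 1) * isoNum 𝔮 ν (t + 1) a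
        - 𝔮 * qNum 𝔮 (b - t) * isoNum 𝔮 ν (t + 2) a) ≤ (𝔮 + 1) * c₁ ∧
      c₂ = isoNum 𝔮 ν t b + (qNum 𝔮 (b + 1) - qNum 𝔮 (b + 1 - t)) ∧
      c₁ * c₂ ≤ (F.ncard : ℝ) * G.ncard := by
  obtain ⟨M, hM, T, hT, hTM⟩ := exists_isotropicSubspaces_pair hB hN hV
    (show t ≤ b + 1 by omega) hb
  exact ⟨_, _, le_ncard_C₁ hB hN hV hM hT hTM (by omega),
    ncard_C₂ hB hN hV hM hT hTM (by omega),
    h.le (isNontrivialCross_C₁_C₂ hB hN hV ht htb (by omega) hM hT hTM)⟩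

theorem IsMaxNontrivialCross.bounds (hB : B.IsAlt) (hN : B.Nondegenerate)
    (hV : finrank K V = 2 * ν) (ht : 1 ≤ t) (htb : t + 1 ≤ b)
    (h₁ : 2 * a + b + t + 3 ≤ 2 * ν) (h₂ : a + 2 * b + t + 3 ≤ 2 * ν)
    (h : IsMaxNontrivialCross B a b t F G) :
    3 * (qNum 𝔮 (t + 1) * (isoNum 𝔮 ν (t + 1) a * isoNum 𝔮 ν t b))
        ≤ 4 * ((F.ncard : ℝ) * G.ncard) ∧
      3 * (qNum 𝔮 (b - t + 1) * (isoNum 𝔮 ν (t + 1) a * isoNum 𝔮 ν t b))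
        ≤ 4 * ((F.ncard : ℝ) * G.ncard) := by
  have hq : (2 : ℝ) ≤ 𝔮 := two_le_card
  constructor
  · have h1 := h.C₃_C₄_le hB hN hV ht htb (by omega)
    have h2 := three_mul_le_four_mul_C₃_C₄ (a := a) (b := b) (t := t) (ν := ν) hq (by omega)
    linarith
  · obtain ⟨c₁, c₂, hc₁, hc₂, hle⟩ := h.exists_C₁_C₂_le hB hN hV ht htb (by omega)
    have h1 := qNum_mono hq (show b + 1 - t ≤ b + 1 by omega)
    have h2 := three_mul_le_four_mul_C₁_C₂ (c₂ := c₂) hq (by omega) (by omega) hc₁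
      (by rw [hc₂]; linarith)
    linarith

theorem IsMaxNontrivialCross.nonempty (hB : B.IsAlt) (hN : B.Nondegenerate)
    (hV : finrank K V = 2 * ν) (ht : 1 ≤ t) (hta : t + 1 ≤ a) (htb : t + 1 ≤ b)
    (h₁ : 2 * a + b + t + 3 ≤ 2 * ν) (h₂ : a + 2 * b + t + 3 ≤ 2 * ν)
    (h : IsMaxNontrivialCross B a b t F G) : F.Nonempty ∧ G.Nonempty := by
  have hq : (2 : ℝ) ≤ 𝔮 := two_le_card
  have h1 := (h.bounds hB hN hV ht htb h₁ h₂).1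
  have p := qNum_pos hq (show 1 ≤ t + 1 by omega)
  have n₁ := isoNum_pos hq hta (show a ≤ ν by omega)
  have n₂ := isoNum_pos hq (show t ≤ b by omega) (show b ≤ ν by omega)
  have h2 : 0 < qNum 𝔮 (t + 1) * (isoNum 𝔮 ν (t + 1) a * isoNum 𝔮 ν t b) := by positivity
  constructor
  · by_contra hne
    rw [Set.not_nonempty_iff_eq_empty] at hne
    simp only [hne, Set.ncard_empty, Nat.cast_zero, zero_mul] at h1
    linarith
  · by_contra hne
    rw [Set.not_nonempty_iff_eq_empty] at hne
    simp only [hne, Set.ncard_empty, Nat.cast_zero, mul_zero] at h1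
    linarith

theorem IsMaxNontrivialCross.classify_of_common (hB : B.IsAlt) (hN : B.Nondegenerate)
    (hV : finrank K V = 2 * ν) (ht : 1 ≤ t) (hta : t + 1 ≤ a) (htb : t + 1 ≤ b)
    (h₁ : 2 * a + b + t + 3 ≤ 2 * ν) (h₂ : a + 2 * b + t + 3 ≤ 2 * ν)
    (h : IsMaxNontrivialCross B a b t F G) {T : Submodule K V}
    (hT : T ∈ isotropicSubspaces B t) (hTF : ∀ A ∈ F, T ≤ A) :
    (∃ M ∈ isotropicSubspaces B (b + 1), ∃ T ∈ isotropicSubspaces B t, T ≤ M ∧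
      F = C₁ B M T a t ∧ G = C₂ B M T b) ∨
    (∃ S ∈ isotropicSubspaces B (t + 1), F = C₃ B S a ∧ G = C₄ B S b t) := by
  obtain ⟨hF, hG⟩ := h.nonempty hB hN hV ht hta htb h₁ h₂
  obtain ⟨hS, hM⟩ := h.bounds hB hN hV ht htb h₁ h₂
  rcases structure_of_common hB hN hV ht hta htb h₁ h₂ h.1 hS hM hF hG hT hTF with
    ⟨M, hM, T, hT, hTM, hFC, hGC⟩ | ⟨S, hS, hFC, hGC⟩
  · exact Or.inl ⟨M, hM, T, hT, hTM, h.eq_of_subset hF hG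
      (isNontrivialCross_C₁_C₂ hB hN hV ht htb (by omega) hM hT hTM) hFC hGC⟩
  · exact Or.inr ⟨S, hS, h.eq_of_subset hF hG
      (isNontrivialCross_C₃_C₄ hB hN hV ht htb (by omega) hS) hFC hGC⟩

theorem IsMaxNontrivialCross.classify (hB : B.IsAlt) (hN : B.Nondegenerate)
    (hV : finrank K V = 2 * ν) (ht : 1 ≤ t) (hta : t + 1 ≤ a) (htb : t + 1 ≤ b)
    (h₁ : 2 * a + b + t + 3 ≤ 2 * ν) (h₂ : a + 2 * b + t + 3 ≤ 2 * ν)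
    (h : IsMaxNontrivialCross B a b t F G) :
    ((∃ M ∈ isotropicSubspaces B (b + 1), ∃ T ∈ isotropicSubspaces B t, T ≤ M ∧
      F = C₁ B M T a t ∧ G = C₂ B M T b) ∨
    (∃ S ∈ isotropicSubspaces B (t + 1), F = C₃ B S a ∧ G = C₄ B S b t)) ∨
    ((∃ M ∈ isotropicSubspaces B (a + 1), ∃ T ∈ isotropicSubspaces B t, T ≤ M ∧
      G = C₁ B M T b t ∧ F = C₂ B M T a) ∨
    (∃ S ∈ isotropicSubspaces B (t + 1), G = C₃ B S b ∧ F = C₄ B S a t)) := by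
  obtain ⟨hF, hG⟩ := h.nonempty hB hN hV ht hta htb h₁ h₂
  obtain ⟨hS, hM⟩ := h.bounds hB hN hV ht htb h₁ h₂
  obtain ⟨T, hT, hTF | hTG⟩ := exists_common_of_large hB hN hV ht hta htb h₁ h₂ h.1 hS hM hF hG
  · exact Or.inl (h.classify_of_common hB hN hV ht hta htb h₁ h₂ hT hTF)
  · exact Or.inr (h.symm.classify_of_common hB hN hV ht htb hta (by omega) (by omega) hT hTG)

theorem ncard_C₂_le (hB : B.IsAlt) (hN : B.Nondegenerate) (hV : finrank K V = 2 * ν)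
    {M T : Submodule K V} (hM : M ∈ isotropicSubspaces B (b + 1))
    (hT : T ∈ isotropicSubspaces B t) (hTM : T ≤ M) (htb : t ≤ b) :
    ((C₂ B M T b).ncard : ℝ) ≤ isoNum 𝔮 ν t b + qNum 𝔮 (b + 1) := by
  rw [ncard_C₂ hB hN hV hM hT hTM htb]
  have := qNum_nonneg (two_le_card (K := K)) (b + 1 - t)
  linarith

theorem ncard_C₁_le_mul (hB : B.IsAlt) (hN : B.Nondegenerate) (hV : finrank K V = 2 * ν)
    {M T : Submodule K V} (hM : M ∈ isotropicSubspaces B (b + 1))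
    (hT : T ∈ isotropicSubspaces B t) (hTM : T ≤ M) (htb : t ≤ b) :
    ((C₁ B M T a t).ncard : ℝ) ≤ qNum 𝔮 (b - t + 1) * isoNum 𝔮 ν (t + 1) a := by
  have hq : (2 : ℝ) ≤ 𝔮 := two_le_card
  have h1 := ncard_C₁_le hB hN hV (m := a) hM hT hTM htb
  have h2 := mul_nonneg (mul_nonneg (by linarith : 0 ≤ 𝔮) (qNum_nonneg hq (b - t)))
    (isoNum_nonneg hq ν (t + 2) a)
  linarith

theorem IsMaxNontrivialCross.ne_C₂_C₁ (hB : B.IsAlt) (hN : B.Nondegenerate)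
    (hV : finrank K V = 2 * ν) (ht : 1 ≤ t) (htb : t + 1 ≤ b) (hba : b < a)
    (h₁ : 2 * a + b + t + 3 ≤ 2 * ν) (h : IsMaxNontrivialCross B a b t F G)
    {M T : Submodule K V} (hM : M ∈ isotropicSubspaces B (a + 1))
    (hT : T ∈ isotropicSubspaces B t) (hTM : T ≤ M) :
    ¬ (G = C₁ B M T b t ∧ F = C₂ B M T a) := by
  rintro ⟨rfl, rfl⟩
  have hq : (2 : ℝ) ≤ 𝔮 := two_le_card
  obtain ⟨c₁, c₂, hc₁, hc₂, hle⟩ := h.exists_C₁_C₂_le hB hN hV ht htb (by omega)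
  have h1 := qNum_mono hq (show b + 1 - t ≤ b + 1 by omega)
  have h2 := C₁_C₂_swap_lt (c₂ := c₂) hq ht htb hba h₁ hc₁ (by rw [hc₂]; linarith)
    (ncard_C₁_le_mul hB hN hV (a := b) hM hT hTM (by omega))
    (ncard_C₂_le hB hN hV hM hT hTM (by omega)) (by positivity)
  linarith

/-- By `isoNum_mul_comm` and 2[b-t] ≤ [a-t], the exchanged product is at most half of [t+1]·U, below
the guaranteed 3/4. -/
theorem IsMaxNontrivialCross.ne_C₄_C₃ (hB : B.IsAlt) (hN : B.Nondegenerate)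
    (hV : finrank K V = 2 * ν) (ht : 1 ≤ t) (htb : t + 1 ≤ b) (hba : b < a)
    (h₁ : 2 * a + b + t + 3 ≤ 2 * ν) (h : IsMaxNontrivialCross B a b t F G)
    {S : Submodule K V} (hS : S ∈ isotropicSubspaces B (t + 1)) :
    ¬ (G = C₃ B S b ∧ F = C₄ B S a t) := by
  rintro ⟨rfl, rfl⟩
  have hq : (2 : ℝ) ≤ 𝔮 := two_le_card
  have h2 := (h.bounds hB hN hV ht htb h₁ (by omega)).1
  rw [ncard_C₃ hB hN hV hS, ncard_C₄ hB hN hV hS] at h2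
  have h3 := isoNum_mul_comm (ν := ν) (t := t) (a := a) (b := b) hq
  have h4 := (two_pow_mul_qNum_le hq 1 (b - t)).trans
    (qNum_mono hq (show 1 + (b - t) ≤ a - t by omega))
  have pu := qNum_pos hq (show 1 ≤ a - t by omega)
  have ps := qNum_pos hq (show 1 ≤ t + 1 by omega)
  have n₁ := isoNum_pos hq (show t + 1 ≤ a by omega) (show a ≤ ν by omega)
  have n₂ := isoNum_pos hq (show t ≤ b by omega) (show b ≤ ν by omega)
  have n₃ := isoNum_pos hq htb (show b ≤ ν by omega)
  have h5 : 2 * (isoNum 𝔮 ν (t + 1) b * isoNum 𝔮 ν t a)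
      ≤ isoNum 𝔮 ν (t + 1) a * isoNum 𝔮 ν t b := by
    refine le_of_mul_le_mul_right ?_ pu
    have := mul_le_mul_of_nonneg_left h4
      (show 0 ≤ isoNum 𝔮 ν (t + 1) a * isoNum 𝔮 ν t b by positivity)
    linarith
  have h6 := mul_le_mul_of_nonneg_left h5 ps.le
  have h7 : 0 ≤ 𝔮 * qNum 𝔮 t * isoNum 𝔮 ν (t + 1) a * isoNum 𝔮 ν (t + 1) b :=
    mul_nonneg (mul_nonneg (mul_nonneg (by linarith) (qNum_nonneg hq t)) n₁.le) n₃.le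
  have h8 : 0 < qNum 𝔮 (t + 1) * (isoNum 𝔮 ν (t + 1) a * isoNum 𝔮 ν t b) := by positivity
  nlinarith

theorem IsMaxNontrivialCross.ne_C₃_C₄ (hB : B.IsAlt) (hN : B.Nondegenerate)
    (hV : finrank K V = 2 * ν) (ht : 1 ≤ t) (htb : t + 1 ≤ b) (hba : b ≤ a)
    (h₁ : 2 * a + b + t + 3 ≤ 2 * ν)
    (hcase : 2 * t < b ∨ (a, b, t) = (2, 2, 1) ∨ (a, b, t) = (3, 2, 1))
    (h : IsMaxNontrivialCross B a b t F G)
    {S : Submodule K V} (hS : S ∈ isotropicSubspaces B (t + 1)) :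
    ¬ (F = C₃ B S a ∧ G = C₄ B S b t) := by
  rintro ⟨rfl, rfl⟩
  have hq : (2 : ℝ) ≤ 𝔮 := two_le_card
  -- For b > 2t the factor [t+1] is at most half of [b-t+1], so the 3/4 bound already decides; the
  -- exceptional triples need the exact counts.
  rcases lt_or_ge (2 * t) b with hbt | hbt
  · have h2 := (h.bounds hB hN hV ht htb h₁ (by omega)).2
    rw [ncard_C₃ hB hN hV hS, ncard_C₄ hB hN hV hS] at h2
    have n₁ := isoNum_pos hq (show t + 1 ≤ a by omega) (show a ≤ ν by omega)
    have n₂ := isoNum_pos hq (show t ≤ b by omega) (show b ≤ ν by omega)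
    have n₃ := isoNum_pos hq htb (show b ≤ ν by omega)
    have ps := qNum_pos hq (show 1 ≤ t + 1 by omega)
    have h4 := (two_pow_mul_qNum_le hq 1 (t + 1)).trans
      (qNum_mono hq (show 1 + (t + 1) ≤ b - t + 1 by omega))
    have h6 := mul_le_mul_of_nonneg_right h4
      (show 0 ≤ isoNum 𝔮 ν (t + 1) a * isoNum 𝔮 ν t b by positivity)
    have h7 : 0 ≤ 𝔮 * qNum 𝔮 t * isoNum 𝔮 ν (t + 1) a * isoNum 𝔮 ν (t + 1) b :=
      mul_nonneg (mul_nonneg (mul_nonneg (by linarith) (qNum_nonneg hq t)) n₁.le) n₃.le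
    have h8 : 0 < qNum 𝔮 (t + 1) * (isoNum 𝔮 ν (t + 1) a * isoNum 𝔮 ν t b) := by positivity
    nlinarith
  · obtain ⟨ha, rfl, rfl⟩ : (a = 2 ∨ a = 3) ∧ b = 2 ∧ t = 1 := by
      simp only [Prod.mk.injEq] at hcase
      omega
    obtain ⟨c₁, c₂, hc₁, hc₂, hle⟩ := h.exists_C₁_C₂_le hB hN hV ht htb (by omega)
    rw [ncard_C₃ hB hN hV hS, ncard_C₄ hB hN hV hS] at hle
    norm_num [qNum_one] at hc₁ hc₂ hle
    refine absurd hle (not_le.2 (C₃_C₄_lt_C₁_C₂_of_special hq ha (by omega) ?_ ?_))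
    · exact hc₁
    · rw [hc₂, qNum_succ_pow 𝔮 2]
      linarith

theorem IsMaxNontrivialCross.ne_C₄_C₃_of_le (hB : B.IsAlt) (hN : B.Nondegenerate)
    (hV : finrank K V = 2 * ν) (ht : 1 ≤ t) (htb : t + 1 ≤ b) (hba : b ≤ a)
    (h₁ : 2 * a + b + t + 3 ≤ 2 * ν)
    (hcase : 2 * t < b ∨ (a, b, t) = (2, 2, 1) ∨ (a, b, t) = (3, 2, 1))
    (h : IsMaxNontrivialCross B a b t F G)
    {S : Submodule K V} (hS : S ∈ isotropicSubspaces B (t + 1)) :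
    ¬ (G = C₃ B S b ∧ F = C₄ B S a t) := by
  rcases hba.lt_or_eq with hlt | rfl
  · exact h.ne_C₄_C₃ hB hN hV ht htb hlt h₁ hS
  · exact h.symm.ne_C₃_C₄ hB hN hV ht htb hba h₁ hcase hS

theorem IsMaxNontrivialCross.ne_C₁_C₂ (hB : B.IsAlt) (hN : B.Nondegenerate)
    (hV : finrank K V = 2 * ν) (ht : 1 ≤ t) (htb : t + 1 ≤ b) (hba : b ≤ a)
    (h₁ : 2 * a + b + t + 3 ≤ 2 * ν)
    (hcase : b ≤ 2 * t ∧ (a, b, t) ≠ (2, 2, 1) ∧ (a, b, t) ≠ (3, 2, 1))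
    (h : IsMaxNontrivialCross B a b t F G)
    {M T : Submodule K V} (hM : M ∈ isotropicSubspaces B (b + 1))
    (hT : T ∈ isotropicSubspaces B t) (hTM : T ≤ M) :
    ¬ (F = C₁ B M T a t ∧ G = C₂ B M T b) := by
  rintro ⟨rfl, rfl⟩
  have hq : (2 : ℝ) ≤ 𝔮 := two_le_card
  have hle := h.C₃_C₄_le hB hN hV ht htb (by omega)
  rcases hcase.1.lt_or_eq with hbt | rfl
  · exact absurd hle (not_le.2 (C₁_C₂_lt_C₃_C₄_of_lt hq htb hbt (by omega) (by omega) (by omega)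
      (ncard_C₁_le_mul hB hN hV hM hT hTM (by omega))
      (ncard_C₂_le hB hN hV hM hT hTM (by omega)) (by positivity)))
  · have h2 := ncard_C₁_le hB hN hV (m := a) hM hT hTM (by omega)
    rw [show 2 * t - t = t by omega] at h2
    refine absurd hle (not_le.2 (C₁_C₂_lt_C₃_C₄_of_eq hq ht hba (fun h1 => ?_) (by omega)
      h2 (by positivity) (ncard_C₂_le hB hN hV hM hT hTM (by omega))))
    obtain ⟨-, h3, h4⟩ := hcase
    subst h1
    simp only [ne_eq, Prod.mk.injEq, and_true, mul_one] at h3 h4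
    omega

theorem IsMaxNontrivialCross.ne_C₂_C₁_of_le (hB : B.IsAlt) (hN : B.Nondegenerate)
    (hV : finrank K V = 2 * ν) (ht : 1 ≤ t) (htb : t + 1 ≤ b) (hba : b ≤ a)
    (h₁ : 2 * a + b + t + 3 ≤ 2 * ν)
    (hcase : b ≤ 2 * t ∧ (a, b, t) ≠ (2, 2, 1) ∧ (a, b, t) ≠ (3, 2, 1))
    (h : IsMaxNontrivialCross B a b t F G)
    {M T : Submodule K V} (hM : M ∈ isotropicSubspaces B (a + 1))
    (hT : T ∈ isotropicSubspaces B t) (hTM : T ≤ M) :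
    ¬ (G = C₁ B M T b t ∧ F = C₂ B M T a) := by
  rcases hba.lt_or_eq with hlt | rfl
  · exact h.ne_C₂_C₁ hB hN hV ht htb hlt h₁ hM hT hTM
  · exact h.symm.ne_C₁_C₂ hB hN hV ht htb hba h₁ hcase hM hT hTM

end Maximal

end SymplecticPolar

theorem theorem1p2 {K V : Type*} [Field K] [Finite K] [AddCommGroup V] [Module K V]
    (B : LinearMap.BilinForm K V) (hAlt : B.IsAlt) (hNondeg : B.Nondegenerate)
    (ν m₁ m₂ t : ℕ) (hdim : Module.finrank K V = 2 * ν)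
    (ht : 1 ≤ t) (hm₂ : t + 1 ≤ m₂) (hm₁ : m₂ ≤ m₁) (hν : 2 * m₁ + m₂ + t + 3 ≤ 2 * ν)
    (F₁ F₂ : Set (Submodule K V))
    (hF : SymplecticPolar.IsMaxNontrivialCross B m₁ m₂ t F₁ F₂) :
    ((2 * t < m₂ ∨ (m₁, m₂, t) = (2, 2, 1) ∨ (m₁, m₂, t) = (3, 2, 1)) →
      ∃ M ∈ SymplecticPolar.isotropicSubspaces B (m₂ + 1),
      ∃ T ∈ SymplecticPolar.isotropicSubspaces B t, T ≤ M ∧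
        ((F₁ = SymplecticPolar.C₁ B M T m₁ t ∧ F₂ = SymplecticPolar.C₂ B M T m₂) ∨
          (m₁ = m₂ ∧ F₁ = SymplecticPolar.C₂ B M T m₁ ∧ F₂ = SymplecticPolar.C₁ B M T m₂ t))) ∧
    ((m₂ ≤ 2 * t ∧ (m₁, m₂, t) ≠ (2, 2, 1) ∧ (m₁, m₂, t) ≠ (3, 2, 1)) →
      ∃ S ∈ SymplecticPolar.isotropicSubspaces B (t + 1),
        ((F₁ = SymplecticPolar.C₃ B S m₁ ∧ F₂ = SymplecticPolar.C₄ B S m₂ t) ∨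
          (m₁ = m₂ ∧ F₁ = SymplecticPolar.C₄ B S m₁ t ∧ F₂ = SymplecticPolar.C₃ B S m₂))) := by
  -- `finrank` is 0 in infinite dimension, so a positive value forces finite dimension.
  have : FiniteDimensional K V := FiniteDimensional.of_finrank_pos (by omega)
  have : Finite V := Module.finite_of_finite K
  have hcl := hF.classify hAlt hNondeg hdim ht (by omega) hm₂ hν (by omega)
  constructor
  · intro hcase
    rcases hcl with (⟨M, hM, T, hT, hTM, h⟩ | ⟨S, hS, h⟩) |
      (⟨M, hM, T, hT, hTM, h⟩ | ⟨S, hS, h⟩)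
    · exact ⟨M, hM, T, hT, hTM, Or.inl h⟩
    · exact absurd h (hF.ne_C₃_C₄ hAlt hNondeg hdim ht hm₂ hm₁ hν hcase hS)
    · rcases hm₁.lt_or_eq with hlt | rfl
      · exact absurd h (hF.ne_C₂_C₁ hAlt hNondeg hdim ht hm₂ hlt hν hM hT hTM)
      · exact ⟨M, hM, T, hT, hTM, Or.inr ⟨rfl, h.2, h.1⟩⟩
    · exact absurd h (hF.ne_C₄_C₃_of_le hAlt hNondeg hdim ht hm₂ hm₁ hν hcase hS)
  · intro hcase
    rcases hcl with (⟨M, hM, T, hT, hTM, h⟩ | ⟨S, hS, h⟩) |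
      (⟨M, hM, T, hT, hTM, h⟩ | ⟨S, hS, h⟩)
    · exact absurd h (hF.ne_C₁_C₂ hAlt hNondeg hdim ht hm₂ hm₁ hν hcase hM hT hTM)
    · exact ⟨S, hS, Or.inl h⟩
    · exact absurd h (hF.ne_C₂_C₁_of_le hAlt hNondeg hdim ht hm₂ hm₁ hν hcase hM hT hTM)
    · rcases hm₁.lt_or_eq with hlt | rfl
      · exact absurd h (hF.ne_C₄_C₃ hAlt hNondeg hdim ht hm₂ hlt hν hS)
      · exact ⟨S, hS, Or.inr ⟨rfl, h.2, h.1⟩⟩
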